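/- Let $\rho\in(-1,1)\setminus\{0\}$, $m\ge 0$, let $\varepsilon_1,\dots,\varepsilon_m$ be nonzero reals, and let $0<\eta<1/4$, $K>0$ and $\tau>0$. Then there is a constant $c_0>0$ such that for every $c\ge c_0$ there is a constant $C_\tau>0$ for which the following holds; $c_0$ depends only on $\rho,m,(\varepsilon_j),\eta,K,\tau$, and $C_\tau$ only on these and $c$. Let $n,B\ge 1$ be integers with $(\log n)/B\le\eta$, let $E_1,\dots,E_m$ be pairwise disjoint nonempty finite intervals of positive integers (which may depend on $n$ and $B$), and put $\rho_t=\rho+\sum_{j=1}^m\varepsilon_j I_{E_j}(t)$ for $t\ge 1$. Let $(z_{j,t})_{1\le j\le B,\,t\ge 1}$ be i.i.d. random variables with mean $0$ and variance $1$, and let $$y_{j,0}=0,\qquad y_{j,t}=\rho_t\,y_{j,t-1}+z_{j,t}\qquad(1\le j\le B,\ t\ge 1).$$ Let $\underline y_j=(y_{j,1},\dots,y_{j,n})^\top$, with common covariance matrix $\Sigma_n$ and precision matrix $\Omega_n=\Sigma_n^{-1}$, and assume that $$\max_{1\le i\le n}\mathbb E\exp(t\,y_{1,i}^2)\le K<\infty\qquad\text{for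 all }|t|\le\eta .$$ Let $\widehat\Sigma_{n,B}=B^{-1}\sum_{j=1}^B(\underline y_j-\overline y)(\underline y_j-\overline y)^\top$ with $\overline y=B^{-1}\sum_{j=1}^B\underline y_j$, let $\lambda_n=c\sqrt{(\log n)/B}$, and let $\widetilde\Omega_1$ be any solution of $$\min|\Omega|_1\quad\text{subject to}\quad|\widehat\Sigma_{n,B}\,\Omega-I_n|_\infty\le\lambda_n,$$ where $|A|_1=\sum_{i,j}|a_{ij}|$ and $|A|_\infty=\max_{i,j}|a_{ij}|$ (and an arbitrary matrix where there is no solution). Let $[\widetilde\Omega_{n,B}]_{i,j}=\min\big([\widetilde\Omega_1]_{i,j},[\widetilde\Omega_1]_{j,i}\big)$, and denote by $\lambda_1(A)\le\dots\le\lambda_n(A)$ the eigenvalues of a real symmetric matrix $A$. Then $$P\left(\max_{1\le i\le n}\big|\lambda_i(\widetilde\Omega_{n,B})-\lambda_i(\Omega_n)\big|\le C_\tau\sqrt{\frac{\log n}{B}}\right)\ \ge\ 1-4n^{-\tau}.$$ (If $\widetilde\Omega_1$ is not chosen measurably, the event contains a measurable event with at least this probability.) -/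

import Mathlib

open MeasureTheory ProbabilityTheory

/-- The coefficients of the structural change model:
`ρ_t = ρ + ∑_{j=1}^m ε_j 1_{E_j}(t)`, where `E_j = {k_j, …, k_j + h_j - 1}`. -/
noncomputable def scmCoeff (ρ : ℝ) {m : ℕ} (ε : Fin m → ℝ) (k h : Fin m → ℕ) (t : ℕ) : ℝ :=
  ρ + ∑ j, if t ∈ Finset.Ico (k j) (k j + h j) then ε j else 0

/-- The path of the autoregression `y_t = ρ_t y_{t-1} + z_t` for `t ≥ 1`, with `y_0 = 0`. -/
noncomputable def arPath (r z : ℕ → ℝ) : ℕ → ℝ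
  | 0 => 0
  | t + 1 => r (t + 1) * arPath r z t + z (t + 1)

/-- The observed vector `(y_{j,1}, …, y_{j,n})` of the panel `j`; the coordinate `i : Fin n`
is the time `i + 1`. -/
noncomputable def panelObs {Ω : Type*} {B : ℕ} (r : ℕ → ℝ) (z : Fin B → ℕ → Ω → ℝ) (n : ℕ)
    (j : Fin B) (i : Fin n) (ω : Ω) : ℝ :=
  arPath r (fun t => z j t ω) (i + 1)

/-- The innovations `z_{j,t}`, `1 ≤ j ≤ B`, `t ≥ 1`, are i.i.d. with mean zero and variance one.
(The values `z j 0` are not used and not restricted.) -/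
structure IsIIDInnovations {Ω : Type*} [MeasurableSpace Ω] {B : ℕ} (z : Fin B → ℕ → Ω → ℝ)
    (μ : Measure Ω) : Prop where
  measurable : ∀ j t, 1 ≤ t → Measurable (z j t)
  indep : iIndepFun (fun p : Fin B × ℕ => z p.1 (p.2 + 1)) μ
  identDistrib : ∀ j j' t t', 1 ≤ t → 1 ≤ t' → IdentDistrib (z j t) (z j' t') μ μ
  memLp : ∀ j t, 1 ≤ t → MemLp (z j t) 2 μ
  mean_zero : ∀ j t, 1 ≤ t → ∫ ω, z j t ω ∂μ = 0
  variance_one : ∀ j t, 1 ≤ t → variance (z j t) μ = 1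

/-- The moment part of the exponential-type tail condition:
`max_i E exp (t Y_i ^ 2) ≤ K < ∞` for all `|t| ≤ η`. -/
def HasExpTail {Ω : Type*} [MeasurableSpace Ω] {n : ℕ} (Y : Fin n → Ω → ℝ) (μ : Measure Ω)
    (η K : ℝ) : Prop :=
  ∀ i : Fin n, ∀ t : ℝ, |t| ≤ η →
    Integrable (fun ω => Real.exp (t * Y i ω ^ 2)) μ ∧ ∫ ω, Real.exp (t * Y i ω ^ 2) ∂μ ≤ K

/-- The covariance matrix of a random vector. -/
noncomputable def covMatrix {Ω : Type*} [MeasurableSpace Ω] {n : ℕ} (Y : Fin n → Ω → ℝ)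
    (μ : Measure Ω) : Matrix (Fin n) (Fin n) ℝ :=
  Matrix.of fun s t => covariance (Y s) (Y t) μ

/-- The precision matrix of a random vector: the inverse of its covariance matrix. -/
noncomputable def precisionMatrix {Ω : Type*} [MeasurableSpace Ω] {n : ℕ} (Y : Fin n → Ω → ℝ)
    (μ : Measure Ω) : Matrix (Fin n) (Fin n) ℝ :=
  (covMatrix Y μ)⁻¹

/-- The sample mean `B⁻¹ ∑_j x_j` of the vectors `x_1, …, x_B`. -/
noncomputable def sampleMean {n B : ℕ} (x : Fin B → Fin n → ℝ) (s : Fin n) : ℝ :=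
  (B : ℝ)⁻¹ * ∑ j, x j s

/-- The plug-in (sample) covariance matrix `B⁻¹ ∑_j (x_j - x̄)(x_j - x̄)ᵀ`. -/
noncomputable def sampleCov {n B : ℕ} (x : Fin B → Fin n → ℝ) : Matrix (Fin n) (Fin n) ℝ :=
  (B : ℝ)⁻¹ • ∑ j, Matrix.vecMulVec (x j - sampleMean x) (x j - sampleMean x)

/-- `A` is a solution of the constrained `ℓ₁` minimization problem
`min |A|₁` subject to `|S A - I|_∞ ≤ lam`, with the entrywise norms `|A|₁ = ∑ |a_{ij}|` and
`|A|_∞ = max |a_{ij}|`. -/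
structure IsClimeSolution {n : ℕ} (S : Matrix (Fin n) (Fin n) ℝ) (lam : ℝ)
    (A : Matrix (Fin n) (Fin n) ℝ) : Prop where
  feasible : ∀ i j, |(S * A - 1) i j| ≤ lam
  minimal : ∀ A' : Matrix (Fin n) (Fin n) ℝ, (∀ i j, |(S * A' - 1) i j| ≤ lam) →
    ∑ i, ∑ j, |A i j| ≤ ∑ i, ∑ j, |A' i j|

/-- The symmetrization `a_{ij} ∧ a_{ji}` of a square matrix. -/
def minSymm {n : ℕ} (A : Matrix (Fin n) (Fin n) ℝ) : Matrix (Fin n) (Fin n) ℝ :=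
  Matrix.of fun i j => min (A i j) (A j i)

theorem minSymm_isHermitian {n : ℕ} (A : Matrix (Fin n) (Fin n) ℝ) : (minSymm A).IsHermitian := by
  ext i j
  simp [minSymm, min_comm]

theorem precisionMatrix_isHermitian {Ω : Type*} [MeasurableSpace Ω] {n : ℕ} (Y : Fin n → Ω → ℝ)
    (μ : Measure Ω) : (precisionMatrix Y μ).IsHermitian := by
  refine Matrix.IsHermitian.inv ?_
  ext i j
  simp [covMatrix, covariance_comm]

/-- The `i`-th smallest eigenvalue of a real symmetric `n × n` matrix, counted with multiplicity
(Mathlib's `eigenvalues₀` lists them in decreasing order). -/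
noncomputable def orderedEigenvalue {n : ℕ} {A : Matrix (Fin n) (Fin n) ℝ} (hA : A.IsHermitian)
    (i : Fin n) : ℝ :=
  hA.eigenvalues₀ (Fin.cast (Fintype.card_fin n).symm i.rev)

/-! By Weyl's inequality the eigenvalue differences are at most the largest absolute row sum of the
error matrix, so it suffices to bound that row sum by `O(lam)` uniformly in `n`.

The precision matrix `Om` is tridiagonal: it equals `AᵀA`, where the bidiagonal `A` turns the path
into its noise. The tail condition bounds the variances `v_t` of the path by `K / η`. Through
`v_{t+1} = ρ_{t+1}² v_t + 1` this bounds the coefficients from time 2 on and makes the covariances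
decay geometrically, even if some `|ρ_t|` exceed 1. So the column sums of `Om` and of the covariance
matrix `Sg` are at most constants `M` and `W` depending on `K / η` only. Bernstein's inequality and
a union bound give a sample covariance `S` with `|S - Sg|_∞ ≤ σ = O(√(log n / B))`, and `c₀` is
chosen so that `4 M σ ≤ lam`.

The rest is deterministic, with `BandedApprox.tail_le` at its core. The minimization splits into
columns, and a minimizer `x` of the `j`-th problem is entrywise within `O(lam)` of `Om e_j`. Decay
of the error away from the diagonal comes from minimality. Put `w = Sg x`, cut `w` off beyond
distance `L` from `j`, and let `y` be `Om` applied to the result. As `Om` is tridiagonal, `y`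
differs from the truncation of `x` by at most `e` in `ℓ₁`, where `e` is `M` times the mass of `w` at
distances `L` and `L + 1`. The vector `y` violates the constraints by at most `σ |x - y|₁`; mixing
in a little of `Om e_j`, which has slack, repairs this at a cost of at most `|x - y|₁ / 2`.
Minimality then bounds the tail of `x` by `3e` and `|x - y|₁` by `4e`. Applying `Sg`, the tails `T`
of `w` satisfy `T (L+1) ≤ 4WM (T L - T (L+2))`, which forces geometric decay (`tailNorm_decay`) from
a start of order `lam`. The entrywise error is thus `O(lam s^|i-j|)` with `s < 1`, and the row sums
are `O(lam)`. -/

/-! ### Perturbation of ordered eigenvalues. -/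

section Weyl

open Module

variable {E : Type*} [NormedAddCommGroup E] [InnerProductSpace ℝ E]

theorem OrthonormalBasis.norm_sq_eq_sum_repr_sq {ι : Type*} [Fintype ι]
    (b : OrthonormalBasis ι ℝ E) (x : E) :
    ‖x‖ ^ 2 = ∑ j, (b.repr x j) ^ 2 := by
  rw [← b.repr.norm_map, EuclideanSpace.real_norm_sq_eq]

variable [FiniteDimensional ℝ E] {n : ℕ} {T T' : E →ₗ[ℝ] E}

theorem LinearMap.IsSymmetric.inner_apply_self_eq_sum (hT : T.IsSymmetric)
    (hn : finrank ℝ E = n) (x : E) :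
    inner ℝ (T x) x = ∑ j, hT.eigenvalues hn j * ((hT.eigenvectorBasis hn).repr x j) ^ 2 := by
  rw [← (hT.eigenvectorBasis hn).repr.inner_map_map, PiLp.inner_apply]
  refine Finset.sum_congr rfl fun j _ => ?_
  rw [hT.eigenvectorBasis_apply_self_apply hn]
  simp
  ring

/-- The monotonicity half of Weyl's inequality. -/
theorem LinearMap.IsSymmetric.eigenvalues_le_add (hT : T.IsSymmetric) (hT' : T'.IsSymmetric)
    (hn : finrank ℝ E = n) {δ : ℝ}
    (h : ∀ x, inner ℝ (T x) x ≤ inner ℝ (T' x) x + δ * ‖x‖ ^ 2) (i : Fin n) :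
    hT.eigenvalues hn i ≤ hT'.eigenvalues hn i + δ := by
  classical
  let b := hT.eigenvectorBasis hn
  let b' := hT'.eigenvectorBasis hn
  -- These are `n - 1` linear conditions, so some nonzero `x` has no component along the
  -- eigenvectors of `T'` before `i` or of `T` after `i`. Eigenvalues decrease, so on this `x` the
  -- two quadratic forms compare the `i`-th eigenvalues.
  let f : E →ₗ[ℝ] ({j : Fin n // j ≠ i} → ℝ) := LinearMap.pi fun j =>
    if (j : Fin n) < i then b'.toBasis.coord j else b.toBasis.coord j
  have hf : LinearMap.ker f ≠ ⊥ := by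
    apply LinearMap.ker_ne_bot_of_finrank_lt
    rw [Module.finrank_fintype_fun_eq_card, hn, Fintype.card_subtype_compl]
    have := i.pos
    simp
    omega
  obtain ⟨x, hx, hx0⟩ := (Submodule.ne_bot_iff _).1 hf
  have hxj : ∀ j : Fin n, j ≠ i → (if j < i then b'.repr x j else b.repr x j) = 0 := by
    intro j hj
    have := congrFun (LinearMap.mem_ker.1 hx) ⟨j, hj⟩
    simp only [f, LinearMap.pi_apply, Pi.zero_apply] at this
    split_ifs at this ⊢ <;> simpa using this
  have h1 : hT.eigenvalues hn i * ‖x‖ ^ 2 ≤ inner ℝ (T x) x := by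
    rw [hT.inner_apply_self_eq_sum hn, b.norm_sq_eq_sum_repr_sq, Finset.mul_sum]
    refine Finset.sum_le_sum fun j _ => ?_
    rcases le_or_gt j i with hj | hj
    · exact mul_le_mul_of_nonneg_right (hT.eigenvalues_antitone hn hj) (sq_nonneg _)
    · have := hxj j hj.ne'
      rw [if_neg hj.not_gt] at this
      simp [b, show (hT.eigenvectorBasis hn).repr x j = 0 from this]
  have h2 : inner ℝ (T' x) x ≤ hT'.eigenvalues hn i * ‖x‖ ^ 2 := by
    rw [hT'.inner_apply_self_eq_sum hn, b'.norm_sq_eq_sum_repr_sq, Finset.mul_sum]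
    refine Finset.sum_le_sum fun j _ => ?_
    rcases le_or_gt i j with hj | hj
    · exact mul_le_mul_of_nonneg_right (hT'.eigenvalues_antitone hn hj) (sq_nonneg _)
    · have := hxj j hj.ne
      rw [if_pos hj] at this
      simp [b', show (hT'.eigenvectorBasis hn).repr x j = 0 from this]
  have hpos : 0 < ‖x‖ ^ 2 := by positivity
  have := h x
  refine le_of_mul_le_mul_right ?_ hpos
  linarith

end Weyl

/-- The quadratic form of a symmetric matrix is bounded by its largest absolute row sum. -/
theorem abs_sum_mul_mul_le {ι : Type*} [Fintype ι] {D : Matrix ι ι ℝ} {δ : ℝ}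
    (hD : ∀ i j, D i j = D j i) (h : ∀ i, ∑ j, |D i j| ≤ δ) (x : ι → ℝ) :
    |∑ i, (∑ j, D i j * x j) * x i| ≤ δ * ∑ i, x i ^ 2 := by
  have key : ∀ i j, |D i j * x j * x i| ≤ |D i j| * x i ^ 2 / 2 + |D j i| * x j ^ 2 / 2 := by
    intro i j
    rw [hD j i, abs_mul, abs_mul]
    have h1 := abs_nonneg (D i j)
    rw [← sq_abs (x i), ← sq_abs (x j)]
    nlinarith [mul_nonneg h1 (sq_nonneg (|x i| - |x j|))]
  calc |∑ i, (∑ j, D i j * x j) * x i|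
      ≤ ∑ i, ∑ j, |D i j * x j * x i| := by
        refine (Finset.abs_sum_le_sum_abs _ _).trans (Finset.sum_le_sum fun i _ => ?_)
        rw [Finset.sum_mul]
        exact Finset.abs_sum_le_sum_abs _ _
    _ ≤ ∑ i, ∑ j, (|D i j| * x i ^ 2 / 2 + |D j i| * x j ^ 2 / 2) :=
        Finset.sum_le_sum fun i _ => Finset.sum_le_sum fun j _ => key i j
    _ = ∑ i, (∑ j, |D i j|) * x i ^ 2 := by
        simp_rw [Finset.sum_add_distrib]
        rw [Finset.sum_comm (f := fun i j => |D j i| * x j ^ 2 / 2), ← Finset.sum_add_distrib]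
        refine Finset.sum_congr rfl fun i _ => ?_
        rw [Finset.sum_mul, ← Finset.sum_add_distrib]
        exact Finset.sum_congr rfl fun j _ => by ring
    _ ≤ ∑ i, δ * x i ^ 2 :=
        Finset.sum_le_sum fun i _ => mul_le_mul_of_nonneg_right (h i) (sq_nonneg _)
    _ = δ * ∑ i, x i ^ 2 := by rw [Finset.mul_sum]

theorem Matrix.IsHermitian.eigenvalues₀_le_add {ι : Type*} [Fintype ι] [DecidableEq ι]
    {X Y : Matrix ι ι ℝ} (hX : X.IsHermitian) (hY : Y.IsHermitian) {δ : ℝ}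
    (h : ∀ i, ∑ j, |X i j - Y i j| ≤ δ) (k : Fin (Fintype.card ι)) :
    hX.eigenvalues₀ k ≤ hY.eigenvalues₀ k + δ := by
  refine LinearMap.IsSymmetric.eigenvalues_le_add _ _ _ (fun x => ?_) k
  have hD : ∀ i j, (X - Y) i j = (X - Y) j i := fun i j => by
    simpa using ((hX.sub hY).apply i j).symm
  have := (abs_le.1 (abs_sum_mul_mul_le hD h x.ofLp)).2
  rw [EuclideanSpace.real_norm_sq_eq]
  rw [PiLp.inner_apply, PiLp.inner_apply]
  simp only [Matrix.sub_apply, sub_mul, Finset.sum_sub_distrib] at this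
  simp only [Matrix.toLpLin_apply, Matrix.mulVec, dotProduct, RCLike.inner_apply, conj_trivial]
  simp_rw [mul_comm (x.ofLp _) (Finset.sum _ _)]
  linarith

/-- Weyl's inequality for the ordered eigenvalues, with the largest absolute row sum. -/
theorem abs_orderedEigenvalue_sub_le {n : ℕ} {X Y : Matrix (Fin n) (Fin n) ℝ}
    (hX : X.IsHermitian) (hY : Y.IsHermitian) {δ : ℝ}
    (h : ∀ i, ∑ j, |X i j - Y i j| ≤ δ) (i : Fin n) :
    |orderedEigenvalue hX i - orderedEigenvalue hY i| ≤ δ := by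
  have h1 := hX.eigenvalues₀_le_add hY h (Fin.cast (Fintype.card_fin n).symm i.rev)
  have h2 := hY.eigenvalues₀_le_add hX (by simpa only [abs_sub_comm] using h)
    (Fin.cast (Fintype.card_fin n).symm i.rev)
  unfold orderedEigenvalue
  rw [abs_le]
  constructor <;> linarith

/-! ### Deterministic analysis of the `ℓ₁` problem: exponential localization of the error. -/

section Localization

open Matrix

variable {n : ℕ}

/-- The distance `|i - j|` of two indices. -/
def idxDist (i j : Fin n) : ℕ := ((i : ℕ) - j) + ((j : ℕ) - i)

theorem idxDist_comm (i j : Fin n) : idxDist i j = idxDist j i := by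
  unfold idxDist; omega

theorem idxDist_self (i : Fin n) : idxDist i i = 0 := by
  unfold idxDist; omega

theorem sum_pow_comp_le {ι : Type*} {s : ℝ} (hs0 : 0 ≤ s) (hs1 : s < 1) (A : Finset ι)
    (g : ι → ℕ) (hg : Set.InjOn g A) : ∑ a ∈ A, s ^ g a ≤ (1 - s)⁻¹ := by
  classical
  rw [← Finset.sum_image (f := fun k => s ^ k) hg, ← tsum_geometric_of_lt_one hs0 hs1]
  exact (summable_geometric_of_lt_one hs0 hs1).sum_le_tsum _ fun _ _ => by positivity

/-- Each distance occurs at most once on either side of `i`, which leaves two geometric series. -/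
theorem sum_pow_idxDist_le {s : ℝ} (hs0 : 0 ≤ s) (hs1 : s < 1) (i : Fin n) :
    ∑ j, s ^ idxDist i j ≤ 2 * (1 - s)⁻¹ := by
  rw [← Finset.sum_filter_add_sum_filter_not Finset.univ (fun j => j ≤ i), two_mul]
  refine add_le_add (sum_pow_comp_le hs0 hs1 _ _ ?_) (sum_pow_comp_le hs0 hs1 _ _ ?_) <;>
  · intro a ha b hb hab
    simp only [Finset.coe_filter, Finset.mem_univ, true_and, Set.mem_ofPred_eq, Fin.le_def,
      not_le, idxDist] at ha hb hab
    ext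
    omega

/-- The `ℓ₁` mass of `x` at distance at least `L` from `j`. -/
def tailNorm (x : Fin n → ℝ) (j : Fin n) (L : ℕ) : ℝ :=
  ∑ l, if L ≤ idxDist l j then |x l| else 0

theorem tailNorm_nonneg (x : Fin n → ℝ) (j : Fin n) (L : ℕ) : 0 ≤ tailNorm x j L :=
  Finset.sum_nonneg fun l _ => by split_ifs <;> positivity

theorem tailNorm_antitone (x : Fin n → ℝ) (j : Fin n) : Antitone (tailNorm x j) := by
  intro L L' h
  refine Finset.sum_le_sum fun l _ => ?_
  split_ifs with h1 h2 h2
  · exact le_rfl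
  · omega
  · positivity
  · exact le_rfl

theorem abs_le_tailNorm (x : Fin n → ℝ) {j l : Fin n} {L : ℕ} (h : L ≤ idxDist l j) :
    |x l| ≤ tailNorm x j L := by
  unfold tailNorm
  have := Finset.single_le_sum (f := fun l => if L ≤ idxDist l j then |x l| else 0)
    (fun l _ => by split_ifs <;> positivity) (Finset.mem_univ l)
  simpa [h] using this

theorem sum_abs_mulVec_le {A : Matrix (Fin n) (Fin n) ℝ} {c : ℝ}
    (h : ∀ k, ∑ i, |A i k| ≤ c) (x : Fin n → ℝ) :
    ∑ i, |(A *ᵥ x) i| ≤ c * ∑ k, |x k| := by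
  calc ∑ i, |(A *ᵥ x) i| ≤ ∑ i, ∑ k, |A i k| * |x k| := by
        refine Finset.sum_le_sum fun i _ => ?_
        simp only [Matrix.mulVec, dotProduct, ← abs_mul]
        exact Finset.abs_sum_le_sum_abs (fun k => A i k * x k) _
    _ = ∑ k, (∑ i, |A i k|) * |x k| := by
        rw [Finset.sum_comm]; simp_rw [Finset.sum_mul]
    _ ≤ ∑ k, c * |x k| :=
        Finset.sum_le_sum fun k _ => mul_le_mul_of_nonneg_right (h k) (abs_nonneg _)
    _ = c * ∑ k, |x k| := by rw [Finset.mul_sum]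

theorem abs_mulVec_le_of_entries {A : Matrix (Fin n) (Fin n) ℝ} {c : ℝ} (i : Fin n)
    (h : ∀ k, |A i k| ≤ c) (x : Fin n → ℝ) : |(A *ᵥ x) i| ≤ c * ∑ k, |x k| := by
  calc |(A *ᵥ x) i| ≤ ∑ k, |A i k| * |x k| := by
        simp only [Matrix.mulVec, dotProduct, ← abs_mul]
        exact Finset.abs_sum_le_sum_abs (fun k => A i k * x k) _
    _ ≤ ∑ k, c * |x k| :=
        Finset.sum_le_sum fun k _ => mul_le_mul_of_nonneg_right (h k) (abs_nonneg _)
    _ = c * ∑ k, |x k| := by rw [Finset.mul_sum]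

theorem abs_mulVec_le_of_rowSum {A : Matrix (Fin n) (Fin n) ℝ} {c M : ℝ} (hc : 0 ≤ c) (i : Fin n)
    (h : ∑ k, |A i k| ≤ M) (x : Fin n → ℝ) (hx : ∀ k, |x k| ≤ c) : |(A *ᵥ x) i| ≤ M * c := by
  calc |(A *ᵥ x) i| ≤ ∑ k, |A i k| * |x k| := by
        simp only [Matrix.mulVec, dotProduct, ← abs_mul]
        exact Finset.abs_sum_le_sum_abs (fun k => A i k * x k) _
    _ ≤ ∑ k, |A i k| * c :=
        Finset.sum_le_sum fun k _ => mul_le_mul_of_nonneg_left (hx k) (abs_nonneg _)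
    _ ≤ M * c := by rw [← Finset.sum_mul]; exact mul_le_mul_of_nonneg_right h hc

/-- A vector in the constraint set of the `j`-th column problem. -/
def ColFeasible (S : Matrix (Fin n) (Fin n) ℝ) (lam : ℝ) (j : Fin n) (x : Fin n → ℝ) : Prop :=
  ∀ i, |(S *ᵥ x) i - (Pi.single j 1 : Fin n → ℝ) i| ≤ lam

/-- The standing assumptions on the true covariance matrix `Sg`, its banded inverse `Om`, and
the estimate `S` of `Sg`. -/
structure BandedApprox (S Sg Om : Matrix (Fin n) (Fin n) ℝ) (M W σ lam : ℝ) : Prop where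
  mul_eq_one : Sg * Om = 1
  band : ∀ i k, 1 < idxDist i k → Om i k = 0
  symm : ∀ i k, Om i k = Om k i
  inv_colSum : ∀ k, ∑ i, |Om i k| ≤ M
  colSum : ∀ k, ∑ i, |Sg i k| ≤ W
  approx : ∀ i k, |S i k - Sg i k| ≤ σ
  lam_pos : 0 < lam
  sigma_nonneg : 0 ≤ σ
  sigma_le : 4 * M * σ ≤ lam
  W_nonneg : 0 ≤ W
  M_nonneg : 0 ≤ M

/-- A minimizer of the `j`-th column problem. -/
structure ColSolution (S : Matrix (Fin n) (Fin n) ℝ) (lam : ℝ) (j : Fin n) (x : Fin n → ℝ) :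
    Prop where
  feasible : ColFeasible S lam j x
  minimal : ∀ y, ColFeasible S lam j y → ∑ i, |x i| ≤ ∑ i, |y i|

namespace BandedApprox

variable {S Sg Om : Matrix (Fin n) (Fin n) ℝ} {M W σ lam : ℝ}

theorem abs_diff_mulVec_le (h : BandedApprox S Sg Om M W σ lam) (x : Fin n → ℝ) (i : Fin n) :
    |(S *ᵥ x) i - (Sg *ᵥ x) i| ≤ σ * ∑ k, |x k| := by
  rw [← Pi.sub_apply, ← Matrix.sub_mulVec]
  exact abs_mulVec_le_of_entries i (fun k => h.approx i k) x

theorem mulVec_mulVec_inv (h : BandedApprox S Sg Om M W σ lam) (x : Fin n → ℝ) :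
    Sg *ᵥ (Om *ᵥ x) = x := by
  rw [Matrix.mulVec_mulVec, h.mul_eq_one, Matrix.one_mulVec]

theorem inv_mulVec_mulVec (h : BandedApprox S Sg Om M W σ lam) (x : Fin n → ℝ) :
    Om *ᵥ (Sg *ᵥ x) = x := by
  rw [Matrix.mulVec_mulVec, mul_eq_one_comm.1 h.mul_eq_one, Matrix.one_mulVec]

/-- The columns of the true inverse satisfy the constraints with room to spare. -/
theorem abs_col_sub_le (h : BandedApprox S Sg Om M W σ lam) (j i : Fin n) :
    |(S *ᵥ (Om.col j)) i - (Pi.single j 1 : Fin n → ℝ) i| ≤ lam / 4 := by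
  have h1 : Sg *ᵥ (Om.col j) = Pi.single j 1 := by
    rw [← Matrix.mulVec_single_one, h.mulVec_mulVec_inv]
  rw [← h1]
  refine (h.abs_diff_mulVec_le _ i).trans ?_
  have := mul_le_mul_of_nonneg_left (h.inv_colSum j) h.sigma_nonneg
  simp only [Matrix.col_apply] at this ⊢
  linarith [h.sigma_le]

theorem colFeasible_col (h : BandedApprox S Sg Om M W σ lam) (j : Fin n) :
    ColFeasible S lam j (Om.col j) := fun i => by
  have := h.abs_col_sub_le j i
  have := h.lam_pos
  linarith

theorem sum_abs_le (h : BandedApprox S Sg Om M W σ lam) {j : Fin n} {x : Fin n → ℝ}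
    (hx : ColSolution S lam j x) : ∑ i, |x i| ≤ M :=
  (hx.minimal _ (h.colFeasible_col j)).trans (h.inv_colSum j)

theorem abs_mulVec_sub_single_le (h : BandedApprox S Sg Om M W σ lam) {j : Fin n}
    {x : Fin n → ℝ} (hx : ColSolution S lam j x) (i : Fin n) :
    |(Sg *ᵥ x) i - (Pi.single j 1 : Fin n → ℝ) i| ≤ 2 * lam := by
  have h1 := h.abs_diff_mulVec_le x i
  have h2 := hx.feasible i
  have h3 := mul_le_mul_of_nonneg_left (h.sum_abs_le hx) h.sigma_nonneg
  have h4 := h.sigma_le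
  have h5 := h.lam_pos
  rw [abs_le] at *
  constructor <;> linarith

/-- The error is `Om (Sg x - e_j)`, and by symmetry the row sums of `Om` are also at most `M`. This
bound has no decay and serves near the diagonal. -/
theorem abs_sub_inv_le (h : BandedApprox S Sg Om M W σ lam) {j : Fin n}
    {x : Fin n → ℝ} (hx : ColSolution S lam j x) (i : Fin n) :
    |x i - Om i j| ≤ 2 * M * lam := by
  have e : x i - Om i j = (Om *ᵥ (Sg *ᵥ x - Pi.single j 1)) i := by
    rw [Matrix.mulVec_sub, h.inv_mulVec_mulVec, Matrix.mulVec_single_one]; rfl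
  rw [e]
  refine (abs_mulVec_le_of_rowSum (c := 2 * lam) (M := M) (by linarith [h.lam_pos]) i ?_ _
    (h.abs_mulVec_sub_single_le hx)).trans_eq (by ring)
  simp_rw [h.symm i]
  exact h.inv_colSum i

/-- Truncating `w` at distance `L` almost commutes with the banded matrix `Om`. -/
theorem sum_abs_commutator_le (h : BandedApprox S Sg Om M W σ lam) (w : Fin n → ℝ) (j : Fin n)
    (L : ℕ) :
    ∑ k, |(Om *ᵥ fun l => if idxDist l j ≤ L then w l else 0) k -
        (if idxDist k j ≤ L then (Om *ᵥ w) k else 0)| ≤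
      M * (tailNorm w j L - tailNorm w j (L + 2)) := by
  have h1 : ∀ k, |(Om *ᵥ fun l => if idxDist l j ≤ L then w l else 0) k -
        (if idxDist k j ≤ L then (Om *ᵥ w) k else 0)| ≤
      ∑ l, |Om k l| * ((if L ≤ idxDist l j then |w l| else 0) -
        (if L + 2 ≤ idxDist l j then |w l| else 0)) := by
    intro k
    have : (Om *ᵥ fun l => if idxDist l j ≤ L then w l else 0) k -
        (if idxDist k j ≤ L then (Om *ᵥ w) k else 0) =
        ∑ l, Om k l * ((if idxDist l j ≤ L then w l else 0) -
          (if idxDist k j ≤ L then w l else 0)) := by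
      simp only [Matrix.mulVec, dotProduct, mul_sub, Finset.sum_sub_distrib]
      split_ifs <;> simp
    rw [this]
    refine (Finset.abs_sum_le_sum_abs _ _).trans (Finset.sum_le_sum fun l _ => ?_)
    rw [abs_mul]
    -- When `k` and `l` are neighbours or equal, the two cutoffs disagree only if `l` is at distance
    -- `L` or `L + 1` from `j`.
    by_cases hkl : 1 < idxDist k l
    · simp [h.band k l hkl]
    · refine mul_le_mul_of_nonneg_left ?_ (abs_nonneg _)
      unfold idxDist at *
      have := abs_nonneg (w l)
      split_ifs <;> first | omega | simp
  refine (Finset.sum_le_sum fun k _ => h1 k).trans ?_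
  rw [Finset.sum_comm]
  unfold tailNorm
  rw [← Finset.sum_sub_distrib, Finset.mul_sum]
  refine Finset.sum_le_sum fun l _ => ?_
  rw [← Finset.sum_mul]
  refine mul_le_mul_of_nonneg_right (h.inv_colSum l) ?_
  have := abs_nonneg (w l)
  split_ifs <;> first | omega | simp [this]

/-- Comparing a minimizer with its truncation bounds its tail by the boundary terms. -/
theorem tail_le (h : BandedApprox S Sg Om M W σ lam) {j : Fin n}
    {x : Fin n → ℝ} (hx : ColSolution S lam j x) (L : ℕ) :
    tailNorm x j (L + 1) ≤ 3 * (M * (tailNorm (Sg *ᵥ x) j L - tailNorm (Sg *ᵥ x) j (L + 2))) ∧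
    tailNorm (Sg *ᵥ x) j (L + 1) ≤
      4 * W * M * (tailNorm (Sg *ᵥ x) j L - tailNorm (Sg *ᵥ x) j (L + 2)) := by
  set w := Sg *ᵥ x with hw
  set e := M * (tailNorm w j L - tailNorm w j (L + 2)) with he
  set cw : Fin n → ℝ := fun l => if idxDist l j ≤ L then w l else 0 with hcw
  set y := Om *ᵥ cw with hy
  set δ := ∑ k, |x k - y k| with hδ
  have hxw : Om *ᵥ w = x := h.inv_mulVec_mulVec x
  have hyw : Sg *ᵥ y = cw := h.mulVec_mulVec_inv cw
  have hcomm : ∑ k, |y k - (if idxDist k j ≤ L then x k else 0)| ≤ e := by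
    have := h.sum_abs_commutator_le w j L
    rwa [hxw] at this
  have hsplit : ∑ k, |if idxDist k j ≤ L then x k else 0| + tailNorm x j (L + 1) =
      ∑ k, |x k| := by
    unfold tailNorm
    rw [← Finset.sum_add_distrib]
    refine Finset.sum_congr rfl fun k _ => ?_
    split_ifs <;> first | omega | simp
  have hδe : δ ≤ tailNorm x j (L + 1) + e := by
    refine le_trans ?_ (add_le_add_right hcomm _)
    unfold tailNorm
    rw [hδ, ← Finset.sum_add_distrib]
    refine Finset.sum_le_sum fun k _ => ?_
    split_ifs <;> first | omega | skip
    · rw [sub_zero]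
      exact abs_sub _ _
    · rw [zero_add, abs_sub_comm]
  have hye : ∑ k, |y k| + tailNorm x j (L + 1) ≤ ∑ k, |x k| + e := by
    have : ∑ k, |y k| ≤ ∑ k, |if idxDist k j ≤ L then x k else 0| +
        ∑ k, |y k - (if idxDist k j ≤ L then x k else 0)| := by
      rw [← Finset.sum_add_distrib]
      refine Finset.sum_le_sum fun k _ => ?_
      have := abs_add_le (if idxDist k j ≤ L then x k else 0)
        (y k - (if idxDist k j ≤ L then x k else 0))
      simpa using this
    linarith
  have hδ0 : 0 ≤ δ := Finset.sum_nonneg fun _ _ => abs_nonneg _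
  have hσδ : 0 ≤ σ * δ := mul_nonneg h.sigma_nonneg hδ0
  have hlam := h.lam_pos
  have hyx : ∑ k, |y k| ≤ M + δ := by
    have : ∑ k, |y k| ≤ ∑ k, |x k| + ∑ k, |x k - y k| := by
      rw [← Finset.sum_add_distrib]
      refine Finset.sum_le_sum fun k _ => ?_
      have := abs_sub (x k) (x k - y k)
      simpa using this
    linarith [h.sum_abs_le hx]
  -- Within distance `L`, `Sg y` agrees with `Sg x` and only `S - Sg` acts on `x - y`. Beyond it,
  -- both `Sg y` and `e_j` vanish, leaving `σ |y|₁ ≤ σ (M + δ)`.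
  have hyfeas : ∀ i, |(S *ᵥ y) i - (Pi.single j 1 : Fin n → ℝ) i| ≤ lam + σ * δ := by
    intro i
    by_cases hi : idxDist i j ≤ L
    · have h1 := h.abs_diff_mulVec_le (x - y) i
      have h2 := hx.feasible i
      have h3 : (Sg *ᵥ y) i = (Sg *ᵥ x) i := by rw [hyw, hcw, ← hw]; simp [hi]
      rw [Matrix.mulVec_sub, Matrix.mulVec_sub, Pi.sub_apply, Pi.sub_apply, h3] at h1
      simp only [Pi.sub_apply] at h1
      rw [← hδ] at h1
      rw [abs_le] at *
      constructor <;> linarith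
    · have h1 := h.abs_diff_mulVec_le y i
      have h3 : (Sg *ᵥ y) i = 0 := by rw [hyw, hcw]; simp [hi]
      have h4 : i ≠ j := by rintro rfl; simp [idxDist_self] at hi
      have h5 := mul_le_mul_of_nonneg_left hyx h.sigma_nonneg
      have h6 := h.sigma_le
      have h7 := mul_nonneg h.M_nonneg h.sigma_nonneg
      rw [h3, sub_zero] at h1
      rw [Pi.single_eq_of_ne h4, sub_zero]
      linarith
  -- Weight of the slack column `Om e_j`: its residual is at most `lam / 4`, so this weight absorbs
  -- the excess `σ δ`.
  set θ := σ * δ / (σ * δ + lam / 2) with hθ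
  have hden : 0 < σ * δ + lam / 2 := by positivity
  have hθ0 : 0 ≤ θ := by positivity
  have hθ1 : θ ≤ 1 := (div_le_one hden).2 (by linarith)
  have hθmul : θ * (σ * δ + lam / 2) = σ * δ := by rw [hθ]; field_simp
  have hmin : ∑ k, |x k| ≤ ∑ k, |y k| + θ * M := by
    have hf : ColFeasible S lam j ((1 - θ) • y + θ • Om.col j) := by
      intro i
      have h1 := hyfeas i
      have h2 := h.abs_col_sub_le j i
      have e1 : (S *ᵥ ((1 - θ) • y + θ • Om.col j)) i - (Pi.single j 1 : Fin n → ℝ) i =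
          (1 - θ) * ((S *ᵥ y) i - (Pi.single j 1 : Fin n → ℝ) i) +
          θ * ((S *ᵥ Om.col j) i - (Pi.single j 1 : Fin n → ℝ) i) := by
        rw [Matrix.mulVec_add, Matrix.mulVec_smul, Matrix.mulVec_smul]
        simp only [Pi.add_apply, Pi.smul_apply, smul_eq_mul]
        ring
      rw [e1]
      refine (abs_add_le _ _).trans ?_
      rw [abs_mul, abs_mul, abs_of_nonneg hθ0, abs_of_nonneg (sub_nonneg.2 hθ1)]
      have h3 := mul_le_mul_of_nonneg_left h1 (sub_nonneg.2 hθ1)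
      have h4 := mul_le_mul_of_nonneg_left h2 hθ0
      have h5 := mul_nonneg hθ0 hlam.le
      nlinarith
    refine (hx.minimal _ hf).trans ?_
    have h1 : ∑ k, |((1 - θ) • y + θ • Om.col j) k| ≤
        ∑ k, |y k| + θ * ∑ k, |Om k j| := by
      rw [Finset.mul_sum, ← Finset.sum_add_distrib]
      refine Finset.sum_le_sum fun k _ => ?_
      simp only [Pi.add_apply, Pi.smul_apply, smul_eq_mul, Matrix.col_apply]
      refine (abs_add_le _ _).trans ?_
      rw [abs_mul, abs_mul, abs_of_nonneg hθ0, abs_of_nonneg (sub_nonneg.2 hθ1)]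
      nlinarith [mul_nonneg hθ0 (abs_nonneg (y k))]
    exact h1.trans (add_le_add_right (mul_le_mul_of_nonneg_left (h.inv_colSum j) hθ0) _)
  have hθM : θ * M ≤ δ / 2 := by
    have h1 : θ * (lam / 2) ≤ σ * δ := by nlinarith [mul_nonneg hθ0 hσδ]
    have h2 : θ * M * lam ≤ δ / 2 * lam := by
      calc θ * M * lam = 2 * (M * (θ * (lam / 2))) := by ring
        _ ≤ 2 * (M * (σ * δ)) := by gcongr; exact h.M_nonneg
        _ = (4 * M * σ) * (δ / 2) := by ring
        _ ≤ lam * (δ / 2) := mul_le_mul_of_nonneg_right h.sigma_le (by linarith)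
        _ = δ / 2 * lam := by ring
    exact le_of_mul_le_mul_right h2 hlam
  -- Minimality gives tail `≤ e + δ / 2`, and `δ ≤` tail `+ e`, so half of the tail can be absorbed
  -- on the left.
  have htail : tailNorm x j (L + 1) ≤ 3 * e := by linarith
  refine ⟨htail, ?_⟩
  -- `Sg (x - y)` is exactly the part of `w` that was cut off.
  have h1 : tailNorm w j (L + 1) = ∑ k, |(Sg *ᵥ (x - y)) k| := by
    rw [Matrix.mulVec_sub, hyw]
    unfold tailNorm
    refine Finset.sum_congr rfl fun k _ => ?_
    rw [Pi.sub_apply, ← hw, hcw]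
    dsimp only
    split_ifs <;> first | omega | simp
  have h2 : ∑ k, |(Sg *ᵥ (x - y)) k| ≤ W * δ := sum_abs_mulVec_le h.colSum (x - y)
  have h3 : W * δ ≤ W * (4 * e) := mul_le_mul_of_nonneg_left (by linarith) h.W_nonneg
  rw [h1]
  refine (h2.trans h3).trans_eq ?_
  rw [he]; ring

/-- By monotonicity `T (L+2) + T (L+3) ≤ 2 T (L+2) ≤ 2c (T (L+1) - T (L+3))`, so sums of two
consecutive terms contract by `2c / (1 + 2c)`. The start is controlled by `T 2 ≤ c b` and `T 1 ≤ T 3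
+ b`. -/
theorem tailNorm_decay {T : ℕ → ℝ} (hT0 : ∀ L, 0 ≤ T L) (hT : Antitone T) {c b : ℝ}
    (hc : 0 < c) (h : ∀ L, T (L + 1) ≤ c * (T L - T (L + 2))) (h1 : T 1 - T 3 ≤ b) (L : ℕ) :
    T (L + 1) ≤ (2 * c / (1 + 2 * c)) ^ L * (2 * (1 + c) * b) := by
  set s := 2 * c / (1 + 2 * c) with hs
  have hs0 : 0 ≤ s := by positivity
  have hsum : ∀ L, T (L + 1) + T (L + 2) ≤ s ^ L * (T 1 + T 2) := by
    intro L
    induction L with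
    | zero => simp
    | succ L ih =>
      have h2 := h (L + 1)
      have h3 : T (L + 3) ≤ T (L + 2) := hT (by omega)
      have h4 : T (L + 2) + T (L + 3) ≤ s * (T (L + 1) + T (L + 2)) := by
        rw [hs, div_mul_eq_mul_div, le_div_iff₀ (by positivity)]
        rw [show L + 1 + 1 = L + 2 from rfl, show L + 1 + 2 = L + 3 from rfl] at h2
        linarith
      calc T (L + 1 + 1) + T (L + 1 + 2) ≤ s * (T (L + 1) + T (L + 2)) := h4
        _ ≤ s * (s ^ L * (T 1 + T 2)) := mul_le_mul_of_nonneg_left ih hs0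
        _ = s ^ (L + 1) * (T 1 + T 2) := by ring
  have h2 : T 2 ≤ c * b := (h 1).trans (mul_le_mul_of_nonneg_left h1 hc.le)
  have h3 : T 3 ≤ T 2 := hT (by omega)
  have h21 : T 2 ≤ T 1 := hT (by omega)
  have h4 := hsum L
  have h5 : s ^ L * (T 1 + T 2) ≤ s ^ L * (2 * (1 + c) * b) :=
    mul_le_mul_of_nonneg_left (by linarith) (by positivity)
  linarith [hT0 (L + 2)]

/-- Only indices at distance 1 or 2 from `j` contribute; there `e_j` vanishes, so `|(Sg x)_l| ≤ 2
lam`. A geometric weight counts them crudely. -/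
theorem tailNorm_sub_le (h : BandedApprox S Sg Om M W σ lam) {j : Fin n}
    {x : Fin n → ℝ} (hx : ColSolution S lam j x) :
    tailNorm (Sg *ᵥ x) j 1 - tailNorm (Sg *ᵥ x) j 3 ≤ 32 * lam := by
  have hlam := h.lam_pos
  unfold tailNorm
  rw [← Finset.sum_sub_distrib]
  have h1 : ∑ l, (1 / 2 : ℝ) ^ idxDist j l ≤ 4 :=
    (sum_pow_idxDist_le (by norm_num) (by norm_num) j).trans (by norm_num)
  calc _ ≤ ∑ l, 8 * lam * (1 / 2 : ℝ) ^ idxDist j l := by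
        refine Finset.sum_le_sum fun l _ => ?_
        rw [idxDist_comm j l]
        have hp : (0 : ℝ) ≤ 8 * lam * (1 / 2 : ℝ) ^ idxDist l j := by positivity
        split_ifs with h2 h3 h3
        · simpa using hp
        · have hlj : l ≠ j := by rintro rfl; simp [idxDist_self] at h2
          have := h.abs_mulVec_sub_single_le hx l
          rw [Pi.single_eq_of_ne hlj, sub_zero] at this
          have h4 : (1 / 2 : ℝ) ^ 2 ≤ (1 / 2 : ℝ) ^ idxDist l j :=
            pow_le_pow_of_le_one (by norm_num) (by norm_num) (by omega)
          nlinarith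
        · omega
        · simpa using hp
    _ ≤ 32 * lam := by rw [← Finset.mul_sum]; nlinarith

/-- The error of a column solution is of order `lam` and decays exponentially away from the
diagonal. -/
theorem abs_sub_inv_le_pow (h : BandedApprox S Sg Om M W σ lam) (hM : 0 < M) (hW : 0 < W)
    {j : Fin n} {x : Fin n → ℝ} (hx : ColSolution S lam j x) (i : Fin n) :
    |x i - Om i j| ≤ 192 * M * (1 + 4 * W * M) * (2 * (4 * W * M) / (1 + 2 * (4 * W * M)))⁻¹ ^ 2 *
      lam * (2 * (4 * W * M) / (1 + 2 * (4 * W * M))) ^ idxDist i j := by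
  set c := 4 * W * M with hc
  have hc0 : 0 < c := by positivity
  set s := 2 * c / (1 + 2 * c) with hs
  have hs0 : 0 < s := by positivity
  have hs1 : s ≤ 1 := (div_le_one (by positivity)).2 (by linarith)
  have hlam := h.lam_pos
  -- The factor `s⁻¹ ^ 2` pays for the first two distances, where the bound without decay is used;
  -- the recursion starts beyond them.
  rcases le_or_gt (idxDist i j) 2 with hd | hd
  · refine (h.abs_sub_inv_le hx i).trans ?_
    have h1 : s ^ 2 ≤ s ^ idxDist i j := pow_le_pow_of_le_one hs0.le hs1 hd
    have h2 : 192 * M * (1 + c) * s⁻¹ ^ 2 * lam * s ^ 2 = 192 * M * (1 + c) * lam := by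
      field_simp
    have h3 : 192 * M * (1 + c) * s⁻¹ ^ 2 * lam * s ^ 2 ≤
        192 * M * (1 + c) * s⁻¹ ^ 2 * lam * s ^ idxDist i j :=
      mul_le_mul_of_nonneg_left h1 (by positivity)
    have h4 : 0 ≤ M * lam := by positivity
    have h5 : 0 ≤ M * lam * c := by positivity
    nlinarith
  · obtain ⟨L, hL⟩ : ∃ L, idxDist i j = L + 2 := ⟨idxDist i j - 2, by omega⟩
    rw [h.band i j (by omega), sub_zero, hL]
    have h1 : |x i| ≤ tailNorm x j (L + 1 + 1) := abs_le_tailNorm x (by omega)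
    have h2 := (h.tail_le hx (L + 1)).1
    have h3 := tailNorm_decay (T := tailNorm (Sg *ᵥ x) j) (tailNorm_nonneg _ j)
      (tailNorm_antitone _ j) hc0 (fun L => (h.tail_le hx L).2) (h.tailNorm_sub_le hx) L
    rw [← hs] at h3
    have h4 := tailNorm_nonneg (Sg *ᵥ x) j (L + 1 + 2)
    have h5 : 192 * M * (1 + c) * s⁻¹ ^ 2 * lam * s ^ (L + 2) =
        3 * (M * (s ^ L * (2 * (1 + c) * (32 * lam)))) := by
      rw [pow_add]; field_simp; ring
    rw [h5]
    refine h1.trans (h2.trans ?_)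
    gcongr
    linarith

end BandedApprox

/-- Constraints and objective both split over columns: replacing one column by a feasible competitor
leaves the others untouched. -/
theorem IsClimeSolution.colSolution {S A : Matrix (Fin n) (Fin n) ℝ} {lam : ℝ}
    (hA : IsClimeSolution S lam A) (j : Fin n) : ColSolution S lam j (A.col j) where
  feasible i := by
    have := hA.feasible i j
    rw [Matrix.sub_apply, Matrix.one_apply] at this
    rw [Pi.single_apply]
    exact this
  minimal y hy := by
    have h1 := hA.minimal (A.updateCol j y) fun i k => by
      by_cases hk : k = j
      · subst hk
        have := hy i
        rw [Pi.single_apply] at this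
        rw [Matrix.sub_apply, Matrix.one_apply, Matrix.mul_apply]
        simpa [Matrix.mulVec, dotProduct] using this
      · have := hA.feasible i k
        rw [Matrix.sub_apply, Matrix.mul_apply] at this ⊢
        simpa [Matrix.updateCol_ne hk] using this
    rw [Finset.sum_comm, Finset.sum_comm (f := fun i k => |A.updateCol j y i k|),
      ← Finset.add_sum_erase _ _ (Finset.mem_univ j),
      ← Finset.add_sum_erase _ (fun k => ∑ i, |A.updateCol j y i k|) (Finset.mem_univ j)] at h1
    have h2 : ∑ k ∈ Finset.univ.erase j, ∑ i, |A.updateCol j y i k| =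
        ∑ k ∈ Finset.univ.erase j, ∑ i, |A i k| := by
      refine Finset.sum_congr rfl fun k hk => Finset.sum_congr rfl fun i _ => ?_
      rw [Matrix.updateCol_ne (Finset.ne_of_mem_erase hk)]
    rw [h2] at h1
    simp only [Matrix.updateCol_self] at h1
    exact le_of_add_le_add_right h1

/-- The symmetrized solution is within `O(lam)` of the true inverse in the row-sum norm. -/
theorem exists_rowSum_minSymm_sub_le {M W : ℝ} (hM : 0 < M) (hW : 0 < W) :
    ∃ C : ℝ, 0 < C ∧ ∀ (n : ℕ) (S Sg Om A : Matrix (Fin n) (Fin n) ℝ) (σ lam : ℝ),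
      BandedApprox S Sg Om M W σ lam → IsClimeSolution S lam A →
      ∀ i, ∑ j, |minSymm A i j - Om i j| ≤ C * lam := by
  set c := 4 * W * M with hc
  have hc0 : 0 < c := by positivity
  set s := 2 * c / (1 + 2 * c) with hs
  have hs0 : 0 < s := by positivity
  have hs1 : s < 1 := (div_lt_one (by positivity)).2 (by linarith)
  have hs2 : 0 < (1 - s)⁻¹ := inv_pos.2 (by linarith)
  set D := 192 * M * (1 + c) * s⁻¹ ^ 2 with hD
  refine ⟨D * (2 * (1 - s)⁻¹), by positivity, fun n S Sg Om A σ lam h hA i => ?_⟩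
  have hlam := h.lam_pos
  have h1 : ∀ i j, |A i j - Om i j| ≤ D * lam * s ^ idxDist i j := fun i j =>
    h.abs_sub_inv_le_pow hM hW (hA.colSolution j) i
  have h2 : ∀ j, |minSymm A i j - Om i j| ≤ D * lam * s ^ idxDist i j := by
    intro j
    have h3 := h1 i j
    have h4 := h1 j i
    rw [idxDist_comm j i, h.symm j i] at h4
    simp only [minSymm, Matrix.of_apply]
    rcases min_choice (A i j) (A j i) with h5 | h5 <;> rw [h5] <;> assumption
  calc ∑ j, |minSymm A i j - Om i j| ≤ ∑ j, D * lam * s ^ idxDist i j :=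
        Finset.sum_le_sum fun j _ => h2 j
    _ ≤ D * lam * (2 * (1 - s)⁻¹) := by
        rw [← Finset.mul_sum]
        exact mul_le_mul_of_nonneg_left (sum_pow_idxDist_le hs0.le hs1 i) (by positivity)
    _ = D * (2 * (1 - s)⁻¹) * lam := by ring

/-- The minimization problem has a solution as soon as it is feasible. -/
theorem exists_isClimeSolution {S A₀ : Matrix (Fin n) (Fin n) ℝ} {lam : ℝ}
    (h : ∀ i j, |(S * A₀ - 1) i j| ≤ lam) : ∃ A, IsClimeSolution S lam A := by
  let N : Matrix (Fin n) (Fin n) ℝ → ℝ := fun A => ∑ i, ∑ j, |A i j|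
  have hN : Continuous N := by fun_prop
  -- Restricting to a sublevel set of the objective bounds every entry and so gives compactness.
  let F : Set (Matrix (Fin n) (Fin n) ℝ) := {A | (∀ i j, |(S * A - 1) i j| ≤ lam) ∧ N A ≤ N A₀}
  have hF : IsClosed F := by
    have h1 : F = (⋂ i, ⋂ j, {A : Matrix (Fin n) (Fin n) ℝ | |(S * A - 1) i j| ≤ lam}) ∩
        {A | N A ≤ N A₀} := by
      ext A
      simp [F]
    rw [h1]
    refine IsClosed.inter (isClosed_iInter fun i => isClosed_iInter fun j =>
      isClosed_le ?_ continuous_const) (isClosed_le hN continuous_const)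
    simp only [Matrix.sub_apply, Matrix.mul_apply]
    fun_prop
  have hFc : IsCompact F := by
    refine (isCompact_univ_pi fun _ : Fin n => isCompact_univ_pi fun _ : Fin n =>
      isCompact_Icc (a := -N A₀) (b := N A₀)).of_isClosed_subset hF ?_
    intro A hA i _ j _
    rw [Set.mem_Icc, ← abs_le]
    refine le_trans ?_ hA.2
    exact (Finset.single_le_sum (f := fun j => |A i j|) (fun _ _ => abs_nonneg _)
      (Finset.mem_univ j)).trans (Finset.single_le_sum (f := fun i => ∑ j, |A i j|)
        (fun _ _ => Finset.sum_nonneg fun _ _ => abs_nonneg _) (Finset.mem_univ i))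
  obtain ⟨A, hA, hmin⟩ := hFc.exists_isMinOn ⟨A₀, h, le_rfl⟩ hN.continuousOn
  refine ⟨A, hA.1, fun A' hA' => ?_⟩
  rcases le_total (N A') (N A₀) with h1 | h1
  · exact hmin ⟨hA', h1⟩
  · exact hA.2.trans h1

theorem BandedApprox.feasible_inv {S Sg Om : Matrix (Fin n) (Fin n) ℝ} {M W σ lam : ℝ}
    (h : BandedApprox S Sg Om M W σ lam) (i j : Fin n) : |(S * Om - 1) i j| ≤ lam := by
  have := h.colFeasible_col j i
  rw [Pi.single_apply] at this
  rw [Matrix.sub_apply, Matrix.one_apply]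
  exact this

end Localization

/-! ### True covariance and precision matrices of the autoregression. -/

section Population

open Matrix

variable {Ω : Type*}

/-- The autoregression driven by the noise `z`, as a random variable. -/
noncomputable def arProc (r : ℕ → ℝ) (z : ℕ → Ω → ℝ) (t : ℕ) (ω : Ω) : ℝ :=
  arPath r (fun t => z t ω) t

theorem arProc_zero (r : ℕ → ℝ) (z : ℕ → Ω → ℝ) : arProc r z 0 = 0 := rfl

theorem arProc_succ (r : ℕ → ℝ) (z : ℕ → Ω → ℝ) (t : ℕ) :
    arProc r z (t + 1) = r (t + 1) • arProc r z t + z (t + 1) := rfl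

variable [MeasurableSpace Ω] {μ : Measure Ω}

/-- A sequence of centered, uncorrelated random variables with unit variance at times `t ≥ 1`. -/
structure IsWhiteNoise (z : ℕ → Ω → ℝ) (μ : Measure Ω) : Prop where
  memLp : ∀ t, 1 ≤ t → MemLp (z t) 2 μ
  mean_zero : ∀ t, 1 ≤ t → ∫ ω, z t ω ∂μ = 0
  covariance_eq_ite : ∀ s t, 1 ≤ s → 1 ≤ t → cov[z s, z t; μ] = if s = t then 1 else 0

theorem IsIIDInnovations.isWhiteNoise [IsProbabilityMeasure μ] {B : ℕ} {z : Fin B → ℕ → Ω → ℝ}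
    (h : IsIIDInnovations z μ) (j : Fin B) : IsWhiteNoise (z j) μ where
  memLp := h.memLp j
  mean_zero := h.mean_zero j
  covariance_eq_ite s t hs ht := by
    split_ifs with hst
    · subst hst
      rw [covariance_self (h.measurable j s hs).aemeasurable, h.variance_one j s hs]
    · have := h.indep.indepFun (i := (j, s - 1)) (j := (j, t - 1)) (by
        simp only [ne_eq, Prod.mk.injEq, true_and]; omega)
      simp only [Nat.sub_add_cancel hs, Nat.sub_add_cancel ht] at this
      exact this.covariance_eq_zero (h.memLp j s hs) (h.memLp j t ht)

namespace IsWhiteNoise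

variable {z : ℕ → Ω → ℝ}

theorem memLp_arProc (h : IsWhiteNoise z μ) (r : ℕ → ℝ) (t : ℕ) : MemLp (arProc r z t) 2 μ := by
  induction t with
  | zero => rw [arProc_zero]; exact MemLp.zero
  | succ t ih =>
    rw [arProc_succ]
    exact (ih.const_smul _).add (h.memLp _ (by omega))

theorem covariance_arProc_self_nonneg (h : IsWhiteNoise z μ) (r : ℕ → ℝ) (t : ℕ) :
    0 ≤ cov[arProc r z t, arProc r z t; μ] := by
  rw [covariance_self (h.memLp_arProc r t).aemeasurable]
  exact variance_nonneg _ _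

variable [IsProbabilityMeasure μ]

theorem integral_arProc (h : IsWhiteNoise z μ) (r : ℕ → ℝ) (t : ℕ) :
    ∫ ω, arProc r z t ω ∂μ = 0 := by
  induction t with
  | zero => simp [arProc_zero]
  | succ t ih =>
    rw [arProc_succ]
    simp only [Pi.add_apply, Pi.smul_apply, smul_eq_mul]
    rw [integral_add (((h.memLp_arProc r t).integrable one_le_two).const_mul _)
      ((h.memLp _ (by omega)).integrable one_le_two), integral_const_mul, ih,
      h.mean_zero _ (by omega)]
    simp

/-- The path at time `s` involves only noise up to time `s`. -/
theorem covariance_arProc_noise (h : IsWhiteNoise z μ) (r : ℕ → ℝ) {s t : ℕ} (hst : s < t) :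
    cov[arProc r z s, z t; μ] = 0 := by
  induction s with
  | zero => rw [arProc_zero]; simp
  | succ s ih =>
    rw [arProc_succ, covariance_add_left ((h.memLp_arProc r s).const_smul _)
      (h.memLp _ (by omega)) (h.memLp _ (by omega)), covariance_smul_left, ih (by omega),
      h.covariance_eq_ite _ _ (by omega) (by omega), if_neg (by omega)]
    simp

theorem covariance_arProc_succ (h : IsWhiteNoise z μ) (r : ℕ → ℝ) {s t : ℕ} (hst : s ≤ t) :
    cov[arProc r z s, arProc r z (t + 1); μ] =
      r (t + 1) * cov[arProc r z s, arProc r z t; μ] := by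
  rw [arProc_succ, covariance_add_right (h.memLp_arProc r s) ((h.memLp_arProc r t).const_smul _)
    (h.memLp _ (by omega)), covariance_smul_right, h.covariance_arProc_noise r (by omega), add_zero]

theorem covariance_arProc_self_succ (h : IsWhiteNoise z μ) (r : ℕ → ℝ) (t : ℕ) :
    cov[arProc r z (t + 1), arProc r z (t + 1); μ] =
      r (t + 1) ^ 2 * cov[arProc r z t, arProc r z t; μ] + 1 := by
  calc cov[arProc r z (t + 1), arProc r z (t + 1); μ]
      = cov[r (t + 1) • arProc r z t + z (t + 1), arProc r z (t + 1); μ] := by rw [← arProc_succ]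
    _ = r (t + 1) * cov[arProc r z t, arProc r z (t + 1); μ] +
          cov[arProc r z (t + 1), z (t + 1); μ] := by
        rw [covariance_add_left ((h.memLp_arProc r t).const_smul _) (h.memLp _ (by omega))
          (h.memLp_arProc r _), covariance_smul_left, covariance_comm (z (t + 1))]
    _ = r (t + 1) ^ 2 * cov[arProc r z t, arProc r z t; μ] + 1 := by
        rw [h.covariance_arProc_succ r le_rfl, arProc_succ,
          covariance_add_left ((h.memLp_arProc r t).const_smul _) (h.memLp _ (by omega))
            (h.memLp _ (by omega)), covariance_smul_left, h.covariance_arProc_noise r (by omega),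
          h.covariance_eq_ite _ _ (by omega) (by omega), if_pos rfl]
        ring

theorem one_le_covariance_arProc_self (h : IsWhiteNoise z μ) (r : ℕ → ℝ) {t : ℕ} (ht : 1 ≤ t) :
    1 ≤ cov[arProc r z t, arProc r z t; μ] := by
  obtain ⟨t, rfl⟩ := Nat.exists_eq_add_of_le' ht
  rw [h.covariance_arProc_self_succ]
  nlinarith [mul_nonneg (sq_nonneg (r (t + 1))) (h.covariance_arProc_self_nonneg r t)]

/-- Bounded variances force the coefficients to be bounded. -/
theorem abs_coeff_le (h : IsWhiteNoise z μ) (r : ℕ → ℝ) {V : ℝ} {t : ℕ} (ht : 1 ≤ t)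
    (hV : cov[arProc r z (t + 1), arProc r z (t + 1); μ] ≤ V) : |r (t + 1)| ≤ √V := by
  rw [h.covariance_arProc_self_succ] at hV
  refine Real.abs_le_sqrt ?_
  nlinarith [mul_le_mul_of_nonneg_left (h.one_le_covariance_arProc_self r ht)
    (sq_nonneg (r (t + 1)))]

/-- Bounded variances force the covariances to decay exponentially. -/
theorem abs_covariance_arProc_le (h : IsWhiteNoise z μ) (r : ℕ → ℝ) {V : ℝ} {n : ℕ}
    (hV : ∀ t, 1 ≤ t → t ≤ n → cov[arProc r z t, arProc r z t; μ] ≤ V) {s d : ℕ} (hs : 1 ≤ s)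
    (hd : s + d ≤ n) :
    |cov[arProc r z s, arProc r z (s + d); μ]| ≤ V * √(1 - V⁻¹) ^ d := by
  have hV1 : 1 ≤ V := (h.one_le_covariance_arProc_self r hs).trans (hV s hs (by omega))
  have hV0 : 0 < V := by linarith
  have hp : 0 ≤ 1 - V⁻¹ := sub_nonneg.2 (inv_le_one_of_one_le₀ hV1)
  -- Keeping the current variance as a factor lets the induction use `r² v_t = v_{t+1} - 1 ≤ v_{t+1}
  -- (1 - V⁻¹)`, with no bound on `r` itself.
  have key : ∀ d, s + d ≤ n → cov[arProc r z s, arProc r z (s + d); μ] ^ 2 ≤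
      V * cov[arProc r z (s + d), arProc r z (s + d); μ] * (1 - V⁻¹) ^ d := by
    intro d
    induction d with
    | zero =>
      intro _
      have h1 := h.one_le_covariance_arProc_self r hs
      have h2 := hV s hs (by omega)
      simp only [add_zero, pow_zero, mul_one]
      nlinarith
    | succ d ih =>
      intro hd
      have ih := ih (by omega)
      rw [← add_assoc] at hd ⊢
      rw [h.covariance_arProc_succ r (by omega), mul_pow]
      have h3 := hV (s + d + 1) (by omega) hd
      have h4 := h.covariance_arProc_self_succ r (s + d)
      set c := cov[arProc r z (s + d + 1), arProc r z (s + d + 1); μ]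
      have h5 : c - 1 ≤ c * (1 - V⁻¹) := by
        have : c * V⁻¹ ≤ 1 := by rw [← div_eq_mul_inv]; exact (div_le_one hV0).2 h3
        linarith
      calc r (s + d + 1) ^ 2 * cov[arProc r z s, arProc r z (s + d); μ] ^ 2
          ≤ r (s + d + 1) ^ 2 * (V * cov[arProc r z (s + d), arProc r z (s + d); μ] *
              (1 - V⁻¹) ^ d) := mul_le_mul_of_nonneg_left ih (sq_nonneg _)
        _ = V * (1 - V⁻¹) ^ d * (c - 1) := by rw [h4]; ring
        _ ≤ V * (1 - V⁻¹) ^ d * (c * (1 - V⁻¹)) :=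
            mul_le_mul_of_nonneg_left h5 (by positivity)
        _ = V * c * (1 - V⁻¹) ^ (d + 1) := by ring
  have h1 := key d hd
  have h2 := hV (s + d) (by omega) hd
  refine abs_le_of_sq_le_sq ?_ (by positivity)
  rw [mul_pow, ← pow_mul, mul_comm d 2, pow_mul, Real.sq_sqrt hp]
  refine h1.trans (mul_le_mul_of_nonneg_right ?_ (by positivity))
  nlinarith

end IsWhiteNoise

/-- The lower bidiagonal matrix that recovers the noise from the autoregression. -/
def arOperator (r : ℕ → ℝ) (n : ℕ) : Matrix (Fin n) (Fin n) ℝ :=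
  Matrix.of fun i k =>
    (if k = i then 1 else 0) - (if (k : ℕ) + 1 = i then r ((i : ℕ) + 1) else 0)

/-- The condition `f 0 = 0` accounts for the first row, which has no subdiagonal entry; hence `r 1`
never enters the matrix. -/
theorem sum_arOperator_mul (r : ℕ → ℝ) {n : ℕ} (i : Fin n) (f : ℕ → ℝ) (hf : f 0 = 0) :
    ∑ k, arOperator r n i k * f (k + 1) = f (i + 1) - r (i + 1) * f i := by
  simp only [arOperator, Matrix.of_apply, sub_mul, Finset.sum_sub_distrib, ite_mul, one_mul,
    zero_mul, Finset.sum_ite_eq', Finset.mem_univ, if_true]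
  congr 1
  rcases Nat.eq_zero_or_pos (i : ℕ) with h0 | h0
  · rw [h0, hf, mul_zero]
    exact Finset.sum_eq_zero fun k _ => if_neg (by omega)
  · rw [Finset.sum_eq_single (⟨i - 1, by omega⟩ : Fin n)]
    · simp [Nat.sub_add_cancel h0]
    · intro k _ hk
      refine if_neg fun h => hk ?_
      ext
      simp
      omega
    · simp

theorem sum_ite_le_of_subsingleton {ι : Type*} [Fintype ι] {p : ι → Prop} [DecidablePred p]
    (hp : ∀ a b, p a → p b → a = b) {R : ℝ} (hR : 0 ≤ R) : ∑ a, (if p a then R else 0) ≤ R := by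
  rw [← Finset.sum_filter, Finset.sum_const, nsmul_eq_mul]
  have : (Finset.univ.filter p).card ≤ 1 := Finset.card_le_one.2 fun a ha b hb =>
    hp a b (Finset.mem_filter.1 ha).2 (Finset.mem_filter.1 hb).2
  have : ((Finset.univ.filter p).card : ℝ) ≤ 1 := by exact_mod_cast this
  nlinarith

theorem abs_arOperator_le {r : ℕ → ℝ} {n : ℕ} {R : ℝ}
    (hr : ∀ t, 1 ≤ t → t < n → |r (t + 1)| ≤ R) (i k : Fin n) :
    |arOperator r n i k| ≤ (if k = i then 1 else 0) + (if (k : ℕ) + 1 = i then R else 0) := by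
  simp only [arOperator, Matrix.of_apply]
  refine (abs_sub _ _).trans (add_le_add ?_ ?_)
  · split_ifs <;> simp
  · split_ifs with h
    · exact hr i (by omega) i.2
    · simp

theorem sum_abs_arOperator_row_le {r : ℕ → ℝ} {n : ℕ} {R : ℝ} (hR : 0 ≤ R)
    (hr : ∀ t, 1 ≤ t → t < n → |r (t + 1)| ≤ R) (i : Fin n) :
    ∑ k, |arOperator r n i k| ≤ 1 + R := by
  refine (Finset.sum_le_sum fun k _ => abs_arOperator_le hr i k).trans ?_
  rw [Finset.sum_add_distrib]
  refine add_le_add (sum_ite_le_of_subsingleton ?_ zero_le_one)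
    (sum_ite_le_of_subsingleton ?_ hR)
  · rintro a b rfl rfl; rfl
  · intro a b ha hb; ext; omega

theorem sum_abs_arOperator_col_le {r : ℕ → ℝ} {n : ℕ} {R : ℝ} (hR : 0 ≤ R)
    (hr : ∀ t, 1 ≤ t → t < n → |r (t + 1)| ≤ R) (k : Fin n) :
    ∑ i, |arOperator r n i k| ≤ 1 + R := by
  refine (Finset.sum_le_sum fun i _ => abs_arOperator_le hr i k).trans ?_
  rw [Finset.sum_add_distrib]
  refine add_le_add (sum_ite_le_of_subsingleton ?_ zero_le_one)
    (sum_ite_le_of_subsingleton ?_ hR)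
  · rintro a b rfl rfl; rfl
  · intro a b ha hb; ext; omega

/-- A row of the bidiagonal matrix meets only two adjacent columns. -/
theorem arOperator_gram_band (r : ℕ → ℝ) {n : ℕ} {i k : Fin n} (h : 1 < idxDist i k) :
    ((arOperator r n)ᵀ * arOperator r n) i k = 0 := by
  rw [Matrix.mul_apply]
  refine Finset.sum_eq_zero fun u _ => ?_
  simp only [Matrix.transpose_apply, arOperator, Matrix.of_apply]
  unfold idxDist at h
  simp only [Fin.ext_iff]
  split_ifs <;> first | omega | simp

theorem arOperator_gram_colSum_le {r : ℕ → ℝ} {n : ℕ} {R : ℝ} (hR : 0 ≤ R)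
    (hr : ∀ t, 1 ≤ t → t < n → |r (t + 1)| ≤ R) (k : Fin n) :
    ∑ i, |((arOperator r n)ᵀ * arOperator r n) i k| ≤ (1 + R) ^ 2 := by
  have h1 := sum_abs_mulVec_le (A := (arOperator r n)ᵀ) (c := 1 + R)
    (fun u => sum_abs_arOperator_row_le hR hr u) ((arOperator r n).col k)
  have h2 := mul_le_mul_of_nonneg_left (sum_abs_arOperator_col_le hR hr k)
    (by linarith : 0 ≤ 1 + R)
  rw [sq]
  exact h1.trans h2

variable [IsProbabilityMeasure μ]

/-- Applying `A` to the path returns the noise, whose covariance is the identity, so `A Sg Aᵀ = 1`;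
a one-sided inverse of a square matrix is two-sided. -/
theorem IsWhiteNoise.covMatrix_mul_gram {z : ℕ → Ω → ℝ} (h : IsWhiteNoise z μ) (r : ℕ → ℝ)
    (n : ℕ) :
    covMatrix (fun (i : Fin n) => arProc r z (i + 1)) μ *
      ((arOperator r n)ᵀ * arOperator r n) = 1 := by
  set Sg := covMatrix (fun (i : Fin n) => arProc r z (i + 1)) μ
  set A := arOperator r n
  have key : A * (Sg * Aᵀ) = 1 := by
    ext i k
    have h1 : ∀ i : Fin n, (fun ω => ∑ a, A i a * arProc r z (a + 1) ω) = z (i + 1) := by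
      intro i
      ext ω
      rw [sum_arOperator_mul r i (fun t => arProc r z t ω) (by simp [arProc_zero])]
      simp [arProc_succ]
    have h2 := covariance_fun_sum_fun_sum (μ := μ)
      (X := fun (a : Fin n) ω => A i a * arProc r z (a + 1) ω)
      (Y := fun (a : Fin n) ω => A k a * arProc r z (a + 1) ω)
      (fun a => (h.memLp_arProc r _).const_mul _) (fun a => (h.memLp_arProc r _).const_mul _)
    rw [h1, h1, h.covariance_eq_ite _ _ (by omega) (by omega)] at h2
    simp only [covariance_const_mul_left, covariance_const_mul_right] at h2
    rw [Matrix.one_apply, Matrix.mul_apply]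
    simp only [Matrix.mul_apply, Matrix.transpose_apply, Finset.mul_sum]
    simp only [add_left_inj, ← Fin.ext_iff] at h2
    rw [h2]
    exact Finset.sum_congr rfl fun a _ => Finset.sum_congr rfl fun b _ => by
      simp only [Sg, covMatrix, Matrix.of_apply]; ring
  rw [← Matrix.mul_assoc]
  exact mul_eq_one_comm.1 key

/-- All properties of the true covariance and precision matrices that are used below. -/
theorem IsWhiteNoise.bandedApprox {z : ℕ → Ω → ℝ} (h : IsWhiteNoise z μ) (r : ℕ → ℝ)
    {n : ℕ} {V : ℝ} (hV0 : 0 < V)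
    (hV : ∀ t, 1 ≤ t → t ≤ n → cov[arProc r z t, arProc r z t; μ] ≤ V)
    {S : Matrix (Fin n) (Fin n) ℝ} {σ lam : ℝ} (hσ : 0 ≤ σ) (hlam : 0 < lam)
    (hσlam : 4 * (1 + √V) ^ 2 * σ ≤ lam)
    (hS : ∀ i k, |S i k - covMatrix (fun (i : Fin n) => arProc r z (i + 1)) μ i k| ≤ σ) :
    BandedApprox S (covMatrix (fun (i : Fin n) => arProc r z (i + 1)) μ)
      (precisionMatrix (fun (i : Fin n) => arProc r z (i + 1)) μ)
      ((1 + √V) ^ 2) (V * (2 * (1 - √(1 - V⁻¹))⁻¹)) σ lam := by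
  have hinv := h.covMatrix_mul_gram r n
  have hOm : precisionMatrix (fun (i : Fin n) => arProc r z (i + 1)) μ =
      (arOperator r n)ᵀ * arOperator r n := Matrix.inv_eq_right_inv hinv
  have hq1 : √(1 - V⁻¹) < 1 := by
    rw [Real.sqrt_lt' one_pos]
    have := inv_pos.2 hV0
    linarith
  have hr : ∀ t, 1 ≤ t → t < n → |r (t + 1)| ≤ √V := fun t ht htn =>
    h.abs_coeff_le r ht (hV _ (by omega) (by omega))
  have hentry : ∀ i k : Fin n, |covMatrix (fun (i : Fin n) => arProc r z (i + 1)) μ i k| ≤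
      V * √(1 - V⁻¹) ^ idxDist k i := by
    have hle : ∀ i k : Fin n, i ≤ k →
        |cov[arProc r z (i + 1), arProc r z (k + 1); μ]| ≤ V * √(1 - V⁻¹) ^ idxDist k i := by
      intro i k hik
      have hik' : (i : ℕ) ≤ k := hik
      have := h.abs_covariance_arProc_le r hV (s := i + 1) (d := k - i) (by omega) (by omega)
      rw [show (i : ℕ) + 1 + (k - i) = k + 1 by omega] at this
      rwa [show idxDist k i = k - i by unfold idxDist; omega]
    intro i k
    simp only [covMatrix, Matrix.of_apply]
    rcases le_total i k with hik | hik
    · exact hle i k hik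
    · rw [covariance_comm, idxDist_comm]
      exact hle k i hik
  refine ⟨by rw [hOm, hinv], fun i k hik => by rw [hOm, arOperator_gram_band r hik],
    fun i k => ?_, fun k => by rw [hOm]; exact arOperator_gram_colSum_le (Real.sqrt_nonneg V) hr k,
    fun k => ?_, hS, hlam, hσ, hσlam, ?_, by positivity⟩
  · exact ((precisionMatrix_isHermitian _ μ).apply i k).symm
  · refine (Finset.sum_le_sum fun i _ => hentry i k).trans ?_
    rw [← Finset.mul_sum]
    exact mul_le_mul_of_nonneg_left (sum_pow_idxDist_le (Real.sqrt_nonneg _) hq1 k) hV0.le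
  · have := inv_pos.2 (sub_pos.2 hq1)
    positivity

end Population

/-! ### Independence of the panels as whole sequences. -/

section Independence

variable {Ω : Type*} [MeasurableSpace Ω] {μ : Measure Ω}

/-- Grouping a doubly indexed independent family by its first index. -/
theorem iIndepFun_curry {ι κ E : Type*} [Countable ι] [Countable κ] [MeasurableSpace E]
    {X : ι → κ → Ω → E} (hX : ∀ i j, Measurable (X i j))
    (h : iIndepFun (fun (p : ι × κ) ω => X p.1 p.2 ω) μ) :
    iIndepFun (fun i ω j => X i j ω) μ := by
  have := h.isProbabilityMeasure
  have : ∀ i j, IsProbabilityMeasure (μ.map (X i j)) :=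
    fun i j => Measure.isProbabilityMeasure_map (hX i j).aemeasurable
  have hrow : ∀ i, iIndepFun (X i) μ := fun i =>
    h.precomp (g := fun j => (i, j)) fun a b hab => (Prod.ext_iff.1 hab).2
  have hcomp : (MeasurableEquiv.curry ι κ E) ∘ (fun ω p => X p.1 p.2 ω) =
      fun ω i j => X i j ω := rfl
  rw [iIndepFun_iff_map_fun_eq_infinitePi_map (by fun_prop), ← hcomp,
    ← Measure.map_map (by fun_prop) (by fun_prop), h.map_fun_eq_infinitePi_map (by fun_prop),
    Measure.infinitePi_map_curry (fun i j => μ.map (X i j))]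
  congr with i
  rw [(hrow i).map_fun_eq_infinitePi_map (hX i)]

end Independence

/-! ### Bernstein bounds from exponential moments. -/

section Bernstein

variable {Ω : Type*} [MeasurableSpace Ω] {μ : Measure Ω}

theorem Real.exp_le_one_add_add_sq_mul_exp_abs (x : ℝ) :
    Real.exp x ≤ 1 + x + x ^ 2 * Real.exp |x| := by
  have h := Complex.norm_exp_sub_sum_le_norm_mul_exp (x : ℂ) 2
  simp only [Finset.sum_range_succ, Finset.sum_range_zero, pow_zero, pow_one, zero_add,
    Nat.factorial, Nat.cast_one, div_one, mul_one, Complex.norm_real, Real.norm_eq_abs,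
    sq_abs] at h
  have h2 : Complex.exp x - (1 + (x : ℂ)) = ((Real.exp x - (1 + x) : ℝ) : ℂ) := by push_cast; rfl
  rw [h2, Complex.norm_real, Real.norm_eq_abs] at h
  linarith [(abs_le.1 h).2]

/-- Half of the exponent `η |x|` absorbs the square, the other half absorbs `exp |s x|`. -/
theorem sq_mul_exp_abs_le {η s x : ℝ} (hη : 0 < η) (hs : |s| ≤ η / 2) :
    (s * x) ^ 2 * Real.exp |s * x| ≤ s ^ 2 * (8 / η ^ 2) * Real.exp (η * |x|) := by
  have h1 : x ^ 2 ≤ 8 / η ^ 2 * Real.exp (η / 2 * |x|) := by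
    have h2 := Real.quadratic_le_exp_of_nonneg (x := η / 2 * |x|) (by positivity)
    have h3 : 0 ≤ η / 2 * |x| := by positivity
    have h4 : η ^ 2 / 8 * x ^ 2 ≤ Real.exp (η / 2 * |x|) := by
      rw [← sq_abs x]; nlinarith
    calc x ^ 2 = 8 / η ^ 2 * (η ^ 2 / 8 * x ^ 2) := by field_simp
      _ ≤ _ := mul_le_mul_of_nonneg_left h4 (by positivity)
  have h5 : Real.exp |s * x| ≤ Real.exp (η / 2 * |x|) := by
    rw [abs_mul]
    exact Real.exp_le_exp.2 (mul_le_mul_of_nonneg_right hs (abs_nonneg x))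
  calc (s * x) ^ 2 * Real.exp |s * x|
      ≤ s ^ 2 * (8 / η ^ 2 * Real.exp (η / 2 * |x|)) * Real.exp (η / 2 * |x|) := by
        rw [mul_pow]; gcongr
    _ = s ^ 2 * (8 / η ^ 2) * (Real.exp (η / 2 * |x|) * Real.exp (η / 2 * |x|)) := by ring
    _ = _ := by rw [← Real.exp_add]; ring_nf

/-- The random variable `W` has mean `m` and an exponential moment bounded by `K`. -/
structure HasExpMoment (W : Ω → ℝ) (μ : Measure Ω) (η K m : ℝ) : Prop where
  measurable : Measurable W
  integrable_exp : Integrable (fun ω => Real.exp (η * |W ω|)) μ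
  integral_exp_le : ∫ ω, Real.exp (η * |W ω|) ∂μ ≤ K
  integral_eq : ∫ ω, W ω ∂μ = m

namespace HasExpMoment

variable {W : Ω → ℝ} {η K m : ℝ}

theorem integrable (h : HasExpMoment W μ η K m) (hη : 0 < η) : Integrable W μ := by
  refine (h.integrable_exp.const_mul η⁻¹).mono' h.measurable.aestronglyMeasurable
    (ae_of_all _ fun ω => ?_)
  rw [Real.norm_eq_abs, ← div_eq_inv_mul, le_div_iff₀ hη, mul_comm]
  linarith [Real.add_one_le_exp (η * |W ω|)]

theorem mul_abs_mean_le (h : HasExpMoment W μ η K m) (hη : 0 < η) : η * |m| ≤ K := by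
  rw [← h.integral_eq]
  calc η * |∫ ω, W ω ∂μ| ≤ η * ∫ ω, |W ω| ∂μ :=
        mul_le_mul_of_nonneg_left abs_integral_le_integral_abs hη.le
    _ = ∫ ω, η * |W ω| ∂μ := (integral_const_mul _ _).symm
    _ ≤ ∫ ω, Real.exp (η * |W ω|) ∂μ := by
        refine integral_mono ((h.integrable hη).abs.const_mul η) h.integrable_exp fun ω => ?_
        dsimp only
        linarith [Real.add_one_le_exp (η * |W ω|)]
    _ ≤ K := h.integral_exp_le

theorem exp_abs_sub_le (h : HasExpMoment W μ η K m) (hη : 0 < η) (ω : Ω) :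
    Real.exp (η * |W ω - m|) ≤ Real.exp K * Real.exp (η * |W ω|) := by
  rw [← Real.exp_add, Real.exp_le_exp]
  have h1 := mul_le_mul_of_nonneg_left (abs_sub (W ω) m) hη.le
  have h2 := h.mul_abs_mean_le hη
  linarith

theorem integrable_exp_mul_sub (h : HasExpMoment W μ η K m) (hη : 0 < η) {s : ℝ}
    (hs : |s| ≤ η / 2) : Integrable (fun ω => Real.exp (s * (W ω - m))) μ := by
  have hm := h.measurable
  refine (h.integrable_exp.const_mul (Real.exp K)).mono'
    (by fun_prop) (ae_of_all _ fun ω => ?_)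
  rw [Real.norm_eq_abs, Real.abs_exp]
  refine le_trans (Real.exp_le_exp.2 ?_) (h.exp_abs_sub_le hη ω)
  refine (le_abs_self _).trans ?_
  rw [abs_mul]
  exact mul_le_mul_of_nonneg_right (by linarith) (abs_nonneg _)

/-- Centering kills the linear term of the expansion; the quadratic remainder is controlled by the
exponential moment, and recentering costs a factor `exp K`. -/
theorem mgf_sub_le [IsProbabilityMeasure μ] (h : HasExpMoment W μ η K m) (hη : 0 < η) {s : ℝ}
    (hs : |s| ≤ η / 2) :
    mgf (fun ω => W ω - m) μ s ≤ Real.exp (s ^ 2 * (8 / η ^ 2 * (Real.exp K * K))) := by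
  have hW := h.integrable hη
  have hc : 0 ≤ s ^ 2 * (8 / η ^ 2) := by positivity
  have h1 : ∀ ω, Real.exp (s * (W ω - m)) ≤
      1 + s * (W ω - m) + s ^ 2 * (8 / η ^ 2) * (Real.exp K * Real.exp (η * |W ω|)) := by
    intro ω
    refine (Real.exp_le_one_add_add_sq_mul_exp_abs _).trans ?_
    have h2 := sq_mul_exp_abs_le (x := W ω - m) hη hs
    have h3 := mul_le_mul_of_nonneg_left (h.exp_abs_sub_le hη ω) hc
    linarith
  have hi0 : Integrable (fun ω => s * (W ω - m)) μ := (hW.sub (integrable_const m)).const_mul s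
  have hi1 : Integrable (fun ω => 1 + s * (W ω - m)) μ := (integrable_const 1).add hi0
  have hi2 : Integrable (fun ω => s ^ 2 * (8 / η ^ 2) * (Real.exp K * Real.exp (η * |W ω|))) μ :=
    (h.integrable_exp.const_mul _).const_mul _
  calc mgf (fun ω => W ω - m) μ s
      ≤ ∫ ω, (1 + s * (W ω - m) +
          s ^ 2 * (8 / η ^ 2) * (Real.exp K * Real.exp (η * |W ω|))) ∂μ :=
        integral_mono (h.integrable_exp_mul_sub hη hs) (hi1.add hi2) h1
    _ = 1 + s ^ 2 * (8 / η ^ 2) * (Real.exp K * ∫ ω, Real.exp (η * |W ω|) ∂μ) := by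
        rw [integral_add hi1 hi2, integral_const_mul, integral_const_mul,
          integral_add (integrable_const 1) hi0,
          integral_const_mul, integral_sub hW (integrable_const m), h.integral_eq]
        simp
    _ ≤ 1 + s ^ 2 * (8 / η ^ 2 * (Real.exp K * K)) := by
        rw [mul_assoc (s ^ 2)]
        gcongr
        exact h.integral_exp_le
    _ ≤ _ := by linarith [Real.add_one_le_exp (s ^ 2 * (8 / η ^ 2 * (Real.exp K * K)))]

theorem neg (h : HasExpMoment W μ η K m) : HasExpMoment (fun ω => -W ω) μ η K (-m) where
  measurable := h.measurable.neg
  integrable_exp := by simpa using h.integrable_exp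
  integral_exp_le := by simpa using h.integral_exp_le
  integral_eq := by rw [integral_neg, h.integral_eq]

end HasExpMoment

/-- The one-sided Bernstein bound for averages of independent variables. -/
theorem measureReal_mean_sub_ge_le [IsProbabilityMeasure μ] {B : ℕ} (hB : 0 < B)
    {W : Fin B → Ω → ℝ} {η K m : ℝ} (hη : 0 < η) (h : ∀ j, HasExpMoment (W j) μ η K m)
    (hind : iIndepFun W μ) {s : ℝ} (hs0 : 0 ≤ s) (hs : s ≤ η / 2) (x : ℝ) :
    μ.real {ω | x ≤ (B : ℝ)⁻¹ * ∑ j, W j ω - m} ≤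
      Real.exp (-(B * (s * x - s ^ 2 * (8 / η ^ 2 * (Real.exp K * K))))) := by
  have hB' : (0 : ℝ) < B := by exact_mod_cast hB
  have hs' : |s| ≤ η / 2 := by rwa [abs_of_nonneg hs0]
  let X : Fin B → Ω → ℝ := fun j ω => W j ω - m
  have hXm : ∀ j, Measurable (X j) := fun j => (h j).measurable.sub_const m
  have hXi : iIndepFun X μ := hind.comp (fun _ w => w - m) fun _ => measurable_id.sub_const m
  have hint : Integrable (fun ω => Real.exp (s * (∑ j, X j) ω)) μ :=
    hXi.integrable_exp_mul_sum hXm fun j _ => (h j).integrable_exp_mul_sub hη hs'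
  have hset : {ω | x ≤ (B : ℝ)⁻¹ * ∑ j, W j ω - m} = {ω | B * x ≤ (∑ j, X j) ω} := by
    ext ω
    have e : (∑ j, X j) ω = B * ((B : ℝ)⁻¹ * ∑ j, W j ω - m) := by
      simp only [X, Finset.sum_apply, Finset.sum_sub_distrib, Finset.sum_const, Finset.card_univ,
        Fintype.card_fin, nsmul_eq_mul]
      field_simp
    simp only [Set.mem_ofPred_eq]
    rw [e]
    exact ⟨fun h => mul_le_mul_of_nonneg_left h hB'.le, fun h => le_of_mul_le_mul_left h hB'⟩
  rw [hset]
  refine (measure_ge_le_exp_mul_mgf _ hs0 hint).trans ?_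
  rw [hXi.mgf_sum hXm]
  have hprod : ∏ j, mgf (X j) μ s ≤
      Real.exp (s ^ 2 * (8 / η ^ 2 * (Real.exp K * K))) ^ B := by
    refine (Finset.prod_le_prod (fun j _ => mgf_nonneg)
      fun j _ => (h j).mgf_sub_le hη hs').trans_eq ?_
    simp
  refine (mul_le_mul_of_nonneg_left hprod (Real.exp_pos _).le).trans_eq ?_
  rw [← Real.exp_nat_mul, ← Real.exp_add]
  ring_nf

/-- The two-sided Bernstein bound for averages of independent variables. -/
theorem measureReal_abs_mean_sub_ge_le [IsProbabilityMeasure μ] {B : ℕ} (hB : 0 < B)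
    {W : Fin B → Ω → ℝ} {η K m : ℝ} (hη : 0 < η) (h : ∀ j, HasExpMoment (W j) μ η K m)
    (hind : iIndepFun W μ) {s : ℝ} (hs0 : 0 ≤ s) (hs : s ≤ η / 2) (x : ℝ) :
    μ.real {ω | x ≤ |(B : ℝ)⁻¹ * ∑ j, W j ω - m|} ≤
      2 * Real.exp (-(B * (s * x - s ^ 2 * (8 / η ^ 2 * (Real.exp K * K))))) := by
  have h1 := measureReal_mean_sub_ge_le hB hη h hind hs0 hs x
  have h2 := measureReal_mean_sub_ge_le hB hη (fun j => (h j).neg)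
    (hind.comp (fun _ w => -w) fun _ => measurable_neg) hs0 hs x
  have hsub : {ω | x ≤ |(B : ℝ)⁻¹ * ∑ j, W j ω - m|} ⊆
      {ω | x ≤ (B : ℝ)⁻¹ * ∑ j, W j ω - m} ∪ {ω | x ≤ (B : ℝ)⁻¹ * ∑ j, -W j ω - -m} := by
    intro ω (hω : x ≤ |_|)
    rcases le_abs.1 hω with h3 | h3
    · exact Or.inl h3
    · refine Or.inr ?_
      simp only [Set.mem_ofPred_eq, Finset.sum_neg_distrib]
      linarith
  refine (measureReal_mono hsub).trans ((measureReal_union_le _ _).trans ?_)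
  linarith

/-- The Bernstein bound at the scale `√(log n / B)`. -/
theorem measureReal_abs_mean_sub_ge_le_rpow [IsProbabilityMeasure μ] {B n : ℕ} (hB : 0 < B)
    (hn : 0 < n) {W : Fin B → Ω → ℝ} {η K m : ℝ} (hη : 0 < η) (hη1 : η ≤ 1 / 4)
    (hnB : Real.log n / B ≤ η) (h : ∀ j, HasExpMoment (W j) μ η K m) (hind : iIndepFun W μ)
    (p : ℝ) :
    μ.real {ω | (p / η + η * (8 / η ^ 2 * (Real.exp K * K))) * √(Real.log n / B) ≤
      |(B : ℝ)⁻¹ * ∑ j, W j ω - m|} ≤ 2 * (n : ℝ) ^ (-p) := by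
  have hB' : (0 : ℝ) < B := by exact_mod_cast hB
  have hn' : (0 : ℝ) < n := by exact_mod_cast hn
  set a := √(Real.log n / B) with ha
  have hlog : 0 ≤ Real.log n / B :=
    div_nonneg (Real.log_nonneg (by exact_mod_cast hn)) hB'.le
  have ha2 : a ^ 2 = Real.log n / B := Real.sq_sqrt hlog
  have ha1 : a ≤ 1 / 2 := by
    rw [ha, Real.sqrt_le_left (by norm_num)]
    linarith
  have ha0 : 0 ≤ a := Real.sqrt_nonneg _
  -- With `s = η a` the exponent is exactly `B a² p = p log n`; `a ≤ 1 / 2` makes `s` admissible.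
  refine (measureReal_abs_mean_sub_ge_le hB hη h hind (s := η * a) (by positivity)
    (by nlinarith) _).trans_eq ?_
  rw [Real.rpow_def_of_pos hn']
  congr 2
  set v := 8 / η ^ 2 * (Real.exp K * K)
  have : B * (η * a * ((p / η + η * v) * a) - (η * a) ^ 2 * v) = B * a ^ 2 * p := by
    field_simp; ring
  rw [this, ha2]
  field_simp

end Bernstein

/-! ### Transfer of moments and independence between panels. -/

section Panels

variable {Ω : Type*} {B : ℕ}

/-- The autoregression as a function of the shifted noise sequence `x = (z_1, z_2, …)`. -/
noncomputable def arFilter (r x : ℕ → ℝ) (t : ℕ) : ℝ := arPath r (fun s => x (s - 1)) t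

theorem measurable_arFilter (r : ℕ → ℝ) (t : ℕ) : Measurable fun x => arFilter r x t := by
  induction t with
  | zero => exact measurable_const
  | succ t ih => exact (ih.const_mul _).add (measurable_pi_apply _)

theorem arPath_eq_arFilter (r z : ℕ → ℝ) (t : ℕ) :
    arPath r z t = arFilter r (fun s => z (s + 1)) t := by
  induction t with
  | zero => rfl
  | succ t ih => simp only [arFilter, arPath] at ih ⊢; rw [ih]; rfl

theorem panelObs_eq_arFilter (r : ℕ → ℝ) (z : Fin B → ℕ → Ω → ℝ) (n : ℕ) (j : Fin B) (i : Fin n)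
    (ω : Ω) : panelObs r z n j i ω = arFilter r (fun s => z j (s + 1) ω) (i + 1) :=
  arPath_eq_arFilter _ _ _

variable [MeasurableSpace Ω] {μ : Measure Ω} {z : Fin B → ℕ → Ω → ℝ}

namespace IsIIDInnovations

theorem iIndepFun_panels (h : IsIIDInnovations z μ) :
    iIndepFun (fun (j : Fin B) ω (t : ℕ) => z j (t + 1) ω) μ :=
  iIndepFun_curry (X := fun j t => z j (t + 1)) (fun j t => h.measurable j _ (by omega)) h.indep

theorem identDistrib_panels (h : IsIIDInnovations z μ) (j j' : Fin B) :
    IdentDistrib (fun ω (t : ℕ) => z j (t + 1) ω) (fun ω (t : ℕ) => z j' (t + 1) ω) μ μ :=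
  IdentDistrib.pi (fun t => h.identDistrib j j' _ _ (by omega) (by omega))
    (h.indep.precomp (g := fun t => (j, t)) fun _ _ hab => (Prod.ext_iff.1 hab).2)
    (h.indep.precomp (g := fun t => (j', t)) fun _ _ hab => (Prod.ext_iff.1 hab).2)

/-- A function of a panel satisfying an exponential moment condition in one panel does so in
every panel, and its copies are independent. -/
theorem hasExpMoment_panels (h : IsIIDInnovations z μ) {F : (ℕ → ℝ) → ℝ} (hF : Measurable F)
    {η K m : ℝ} (j₀ : Fin B)
    (h₀ : HasExpMoment (fun ω => F fun t => z j₀ (t + 1) ω) μ η K m) (j : Fin B) :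
    HasExpMoment (fun ω => F fun t => z j (t + 1) ω) μ η K m := by
  have h1 : IdentDistrib (fun ω => F fun t => z j (t + 1) ω) (fun ω => F fun t => z j₀ (t + 1) ω)
      μ μ := (h.identDistrib_panels j j₀).comp hF
  have h2 := h1.comp (u := fun w => Real.exp (η * |w|)) (by fun_prop)
  refine ⟨hF.comp (measurable_pi_lambda _ fun t => h.measurable j _ (by omega)),
    h2.integrable_iff.2 h₀.integrable_exp, ?_, h1.integral_eq.trans h₀.integral_eq⟩
  exact h2.integral_eq.trans_le h₀.integral_exp_le

theorem iIndepFun_comp_panels (h : IsIIDInnovations z μ) {F : (ℕ → ℝ) → ℝ} (hF : Measurable F) :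
    iIndepFun (fun (j : Fin B) ω => F fun t => z j (t + 1) ω) μ :=
  h.iIndepFun_panels.comp (fun _ => F) fun _ => hF

theorem measurable_panelObs (h : IsIIDInnovations z μ) (r : ℕ → ℝ) (n : ℕ) (j : Fin B)
    (i : Fin n) : Measurable (panelObs r z n j i) := by
  have : panelObs r z n j i = fun ω => arFilter r (fun s => z j (s + 1) ω) (i + 1) := by
    ext ω; exact panelObs_eq_arFilter r z n j i ω
  rw [this]
  exact (measurable_arFilter r _).comp
    (measurable_pi_lambda _ fun t => h.measurable j _ (by omega))

end IsIIDInnovations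

end Panels

/-! ### Exponential moments of coordinates and of their products. -/

section Tails

variable {Ω : Type*} [MeasurableSpace Ω] {μ : Measure Ω} {n : ℕ} {Y : Fin n → Ω → ℝ} {η K : ℝ}

theorem HasExpTail.integral_sq_le (h : HasExpTail Y μ η K) (hη : 0 < η)
    (hm : ∀ i, MemLp (Y i) 2 μ) (i : Fin n) : ∫ ω, Y i ω ^ 2 ∂μ ≤ K / η := by
  obtain ⟨h1, h2⟩ := h i η (abs_of_pos hη).le
  rw [le_div_iff₀ hη, mul_comm, ← integral_const_mul]
  refine (integral_mono ((hm i).integrable_sq.const_mul η) h1 fun ω => ?_).trans h2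
  dsimp only
  linarith [Real.add_one_le_exp (η * Y i ω ^ 2)]

theorem HasExpTail.hasExpMoment (h : HasExpTail Y μ η K) (hη : 0 < η)
    (hm : ∀ i, Measurable (Y i)) (i : Fin n) :
    HasExpMoment (Y i) μ η (Real.exp η * K) (∫ ω, Y i ω ∂μ) := by
  obtain ⟨h1, h2⟩ := h i η (abs_of_pos hη).le
  have hle : ∀ ω, Real.exp (η * |Y i ω|) ≤ Real.exp η * Real.exp (η * Y i ω ^ 2) := by
    intro ω
    rw [← Real.exp_add, Real.exp_le_exp, ← sq_abs (Y i ω)]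
    nlinarith [sq_nonneg (|Y i ω| - 1), abs_nonneg (Y i ω)]
  have hmeas := hm i
  have hint : Integrable (fun ω => Real.exp (η * |Y i ω|)) μ :=
    (h1.const_mul (Real.exp η)).mono' (by fun_prop) (ae_of_all _ fun ω => by
      rw [Real.norm_eq_abs, Real.abs_exp]; exact hle ω)
  refine ⟨hmeas, hint, ?_, rfl⟩
  refine (integral_mono hint (h1.const_mul (Real.exp η)) hle).trans ?_
  rw [integral_const_mul]
  exact mul_le_mul_of_nonneg_left h2 (Real.exp_pos _).le

/-- A product is at most the larger of the two squares in absolute value. -/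
theorem HasExpTail.hasExpMoment_mul (h : HasExpTail Y μ η K) (hη : 0 < η)
    (hm : ∀ i, Measurable (Y i)) (i k : Fin n) :
    HasExpMoment (fun ω => Y i ω * Y k ω) μ η (2 * K) (∫ ω, Y i ω * Y k ω ∂μ) := by
  obtain ⟨h1, h2⟩ := h i η (abs_of_pos hη).le
  obtain ⟨h3, h4⟩ := h k η (abs_of_pos hη).le
  have hle : ∀ ω, Real.exp (η * |Y i ω * Y k ω|) ≤
      Real.exp (η * Y i ω ^ 2) + Real.exp (η * Y k ω ^ 2) := by
    intro ω
    rw [abs_mul, ← sq_abs (Y i ω), ← sq_abs (Y k ω)]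
    have p1 := Real.exp_pos (η * |Y i ω| ^ 2)
    have p2 := Real.exp_pos (η * |Y k ω| ^ 2)
    rcases le_total |Y i ω| |Y k ω| with h5 | h5
    · have : Real.exp (η * (|Y i ω| * |Y k ω|)) ≤ Real.exp (η * |Y k ω| ^ 2) := by
        rw [Real.exp_le_exp, sq]; gcongr
      linarith
    · have : Real.exp (η * (|Y i ω| * |Y k ω|)) ≤ Real.exp (η * |Y i ω| ^ 2) := by
        rw [Real.exp_le_exp, sq]; gcongr
      linarith
  have hmi := hm i
  have hmk := hm k
  have hint : Integrable (fun ω => Real.exp (η * |Y i ω * Y k ω|)) μ :=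
    (h1.add h3).mono' (by fun_prop) (ae_of_all _ fun ω => by
      rw [Real.norm_eq_abs, Real.abs_exp]; exact hle ω)
  refine ⟨by fun_prop, hint, ?_, rfl⟩
  refine (integral_mono hint (h1.add h3) hle).trans ?_
  simp only [Pi.add_apply]
  rw [integral_add h1 h3]
  linarith

theorem HasExpMoment.mono {W : Ω → ℝ} {K' m : ℝ} (h : HasExpMoment W μ η K m) (hK : K ≤ K') :
    HasExpMoment W μ η K' m :=
  ⟨h.measurable, h.integrable_exp, h.integral_exp_le.trans hK, h.integral_eq⟩

end Tails

theorem sampleCov_apply {n B : ℕ} (hB : 0 < B) (x : Fin B → Fin n → ℝ) (s t : Fin n) :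
    sampleCov x s t = (B : ℝ)⁻¹ * ∑ j, x j s * x j t - sampleMean x s * sampleMean x t := by
  have hB' : (B : ℝ) ≠ 0 := by exact_mod_cast hB.ne'
  have h1 : ∀ u, ∑ j, x j u = B * sampleMean x u := fun u => by
    unfold sampleMean; field_simp
  simp only [sampleCov, Matrix.smul_apply, Matrix.sum_apply, Matrix.vecMulVec_apply, Pi.sub_apply,
    smul_eq_mul]
  have h2 : ∀ j, (x j s - sampleMean x s) * (x j t - sampleMean x t) =
      x j s * x j t - x j s * sampleMean x t - sampleMean x s * x j t +
        sampleMean x s * sampleMean x t := fun j => by ring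
  simp only [h2, Finset.sum_add_distrib, Finset.sum_sub_distrib, ← Finset.sum_mul,
    ← Finset.mul_sum, h1, Finset.sum_const, Finset.card_univ, Fintype.card_fin, nsmul_eq_mul]
  field_simp
  ring

/-! ### Uniform concentration of the sample covariance matrix. -/

section Concentration

variable {Ω : Type*} [MeasurableSpace Ω] {μ : Measure Ω} [IsProbabilityMeasure μ]

/-- The constant in the uniform deviation bound for the sample covariance matrix. -/
noncomputable def deviationConst (η K τ : ℝ) : ℝ :=
  (τ + 2) / η + η * (8 / η ^ 2 *
    (Real.exp ((Real.exp η + 2) * K) * ((Real.exp η + 2) * K)))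

theorem deviationConst_pos {η K τ : ℝ} (hη : 0 < η) (hK : 0 < K) (hτ : 0 < τ) :
    0 < deviationConst η K τ := by
  unfold deviationConst
  positivity

/-- The sample covariance matrix is uniformly close to the true one with high probability. -/
theorem IsIIDInnovations.exists_sampleCov_close {B n : ℕ} (hB : 0 < B) (hn : 0 < n)
    {z : Fin B → ℕ → Ω → ℝ} (h : IsIIDInnovations z μ) (r : ℕ → ℝ) {η K τ : ℝ} (hη : 0 < η)
    (hη1 : η ≤ 1 / 4) (hK : 0 < K) (hτ : 0 < τ) (hnB : Real.log n / B ≤ η)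
    (htail : HasExpTail (panelObs r z n ⟨0, hB⟩) μ η K) :
    ∃ G : Set Ω, MeasurableSet G ∧ 1 - 4 * (n : ℝ) ^ (-τ) ≤ μ.real G ∧
      ∀ ω ∈ G, ∀ i k, |sampleCov (fun j i => panelObs r z n j i ω) i k -
        covMatrix (panelObs r z n ⟨0, hB⟩) μ i k| ≤
          (deviationConst η K τ + deviationConst η K τ ^ 2) * √(Real.log n / B) := by
  set D := deviationConst η K τ with hD
  set a := √(Real.log n / B) with ha
  set Y := panelObs r z n ⟨0, hB⟩ with hY
  have hD0 : 0 < D := deviationConst_pos hη hK hτ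
  have ha0 : 0 ≤ a := Real.sqrt_nonneg _
  have ha1 : a ≤ 1 := by
    rw [ha, Real.sqrt_le_left (by norm_num)]
    linarith
  have hwn := h.isWhiteNoise ⟨0, hB⟩
  have hYm : ∀ i, Measurable (Y i) := fun i => h.measurable_panelObs r n _ i
  have hYL : ∀ i, MemLp (Y i) 2 μ := fun i => hwn.memLp_arProc r (i + 1)
  have hY0 : ∀ i, ∫ ω, Y i ω ∂μ = 0 := fun i => hwn.integral_arProc r (i + 1)
  have hcov : ∀ i k, covMatrix Y μ i k = ∫ ω, Y i ω * Y k ω ∂μ := by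
    intro i k
    simp only [covMatrix, Matrix.of_apply]
    rw [covariance_eq_sub (hYL i) (hYL k), hY0, zero_mul, sub_zero]
    rfl
  have hYobs : ∀ (j : Fin B) (i : Fin n), panelObs r z n j i =
      fun ω => arFilter r (fun s => z j (s + 1) ω) (i + 1) := fun j i =>
    funext fun ω => panelObs_eq_arFilter r z n j i ω
  have hexp := Real.exp_pos η
  have hmean : ∀ i : Fin n, μ.real {ω | D * a ≤
      |(B : ℝ)⁻¹ * ∑ j, panelObs r z n j i ω - 0|} ≤ 2 * (n : ℝ) ^ (-(τ + 2)) := by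
    intro i
    have hF : Measurable fun x => arFilter r x (i + 1) := measurable_arFilter r _
    -- `(exp η + 2) K` dominates the moment constants of both coordinates and products, so one
    -- deviation constant serves both.
    have h1 := (htail.hasExpMoment hη hYm i).mono
      (show Real.exp η * K ≤ (Real.exp η + 2) * K by nlinarith)
    rw [hY0] at h1
    have h2 := h.hasExpMoment_panels hF (η := η) (K := (Real.exp η + 2) * K) (m := 0) ⟨0, hB⟩
      (by rw [← hYobs ⟨0, hB⟩ i]; exact h1)
    have := measureReal_abs_mean_sub_ge_le_rpow hB hn hη hη1 hnB h2
      (h.iIndepFun_comp_panels hF) (τ + 2)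
    simp only [hYobs]
    exact this
  have hprod : ∀ i k : Fin n, μ.real {ω | D * a ≤
      |(B : ℝ)⁻¹ * ∑ j, panelObs r z n j i ω * panelObs r z n j k ω - covMatrix Y μ i k|} ≤
        2 * (n : ℝ) ^ (-(τ + 2)) := by
    intro i k
    have hF : Measurable fun x => arFilter r x (i + 1) * arFilter r x (k + 1) :=
      (measurable_arFilter r _).mul (measurable_arFilter r _)
    have h1 := (htail.hasExpMoment_mul hη hYm i k).mono
      (show 2 * K ≤ (Real.exp η + 2) * K by nlinarith)
    rw [← hcov] at h1
    have h2 := h.hasExpMoment_panels hF (η := η) (K := (Real.exp η + 2) * K)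
      (m := covMatrix Y μ i k) ⟨0, hB⟩ (by
        have e1 := hYobs ⟨0, hB⟩ i
        have e2 := hYobs ⟨0, hB⟩ k
        rw [← hY] at e1 e2
        rw [e1, e2] at h1
        exact h1)
    have := measureReal_abs_mean_sub_ge_le_rpow hB hn hη hη1 hnB h2
      (h.iIndepFun_comp_panels hF) (τ + 2)
    simp only [hYobs]
    exact this
  let Bad : Set Ω := (⋃ i : Fin n, {ω | D * a ≤
      |(B : ℝ)⁻¹ * ∑ j, panelObs r z n j i ω - 0|}) ∪
    ⋃ i : Fin n, ⋃ k : Fin n, {ω | D * a ≤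
      |(B : ℝ)⁻¹ * ∑ j, panelObs r z n j i ω * panelObs r z n j k ω - covMatrix Y μ i k|}
  have hobs : ∀ j i, Measurable (panelObs r z n j i) := fun j i => h.measurable_panelObs r n j i
  have hBadm : MeasurableSet Bad := by
    refine MeasurableSet.union (MeasurableSet.iUnion fun i => ?_)
      (MeasurableSet.iUnion fun i => MeasurableSet.iUnion fun k => ?_) <;>
    · refine measurableSet_le measurable_const ?_
      fun_prop
  have hn' : (0 : ℝ) < n := by exact_mod_cast hn
  have hn1 : (1 : ℝ) ≤ n := by exact_mod_cast hn
  -- The union runs over `n` means and `n²` products: `2 (n + n²) p ≤ 4 n² p = 4 n^(-τ)`, hence the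
  -- exponent `τ + 2`.
  set p := (n : ℝ) ^ (-(τ + 2)) with hp
  have hp0 : 0 ≤ p := Real.rpow_nonneg hn'.le _
  have hpn : (n : ℝ) ^ 2 * p = (n : ℝ) ^ (-τ) := by
    rw [hp, ← Real.rpow_natCast, ← Real.rpow_add hn']
    congr 1
    push_cast
    ring
  have hBad : μ.real Bad ≤ 4 * (n : ℝ) ^ (-τ) := by
    calc μ.real Bad ≤ n * (2 * p) + n * (n * (2 * p)) := by
          refine (measureReal_union_le _ _).trans (add_le_add ?_ ?_)
          · refine (measureReal_iUnion_fintype_le _).trans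
              ((Finset.sum_le_sum fun i _ => hmean i).trans_eq ?_)
            simp
          · refine (measureReal_iUnion_fintype_le _).trans
              ((Finset.sum_le_sum fun i _ => (measureReal_iUnion_fintype_le _).trans
                (Finset.sum_le_sum fun k _ => hprod i k)).trans_eq ?_)
            simp
      _ ≤ 4 * ((n : ℝ) ^ 2 * p) := by
          nlinarith [mul_nonneg hn'.le hp0,
            mul_nonneg (mul_nonneg hn'.le hp0) (sub_nonneg.2 hn1)]
      _ = 4 * (n : ℝ) ^ (-τ) := by rw [hpn]
  refine ⟨Badᶜ, hBadm.compl, ?_, fun ω hω i k => ?_⟩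
  · rw [probReal_compl_eq_one_sub hBadm]
    linarith
  · simp only [Bad, Set.mem_compl_iff, Set.mem_union, Set.mem_iUnion, Set.mem_ofPred_eq, not_or,
      not_exists, not_le, sub_zero] at hω
    obtain ⟨h1, h2⟩ := hω
    rw [sampleCov_apply hB]
    have h3 : |sampleMean (fun j i => panelObs r z n j i ω) i *
        sampleMean (fun j i => panelObs r z n j i ω) k| ≤ D * a * (D * a) := by
      rw [abs_mul]
      exact mul_le_mul (h1 i).le (h1 k).le (abs_nonneg _) (by positivity)
    have h4 := h2 i k
    -- The product of sample means is of order `a²`, and `a ≤ 1`.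
    have h5 : D * a * (D * a) ≤ D ^ 2 * a := by
      nlinarith [mul_nonneg (sq_nonneg D) (mul_nonneg ha0 (sub_nonneg.2 ha1))]
    rw [abs_lt] at h4
    rw [abs_le] at h3 ⊢
    constructor <;> linarith

end Concentration

/-! ### Combination of the probabilistic and deterministic bounds. -/

theorem lemma5p1 (ρ : ℝ) (hρ : ρ ∈ Set.Ioo (-1 : ℝ) 1) (hρ0 : ρ ≠ 0)
    (m : ℕ) (ε : Fin m → ℝ) (hε : ∀ j, ε j ≠ 0)
    (η K : ℝ) (hη0 : 0 < η) (hη : η < 1 / 4) (hK : 0 < K) (τ : ℝ) (hτ : 0 < τ) :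
    ∃ c₀ : ℝ, 0 < c₀ ∧ ∀ c : ℝ, c₀ ≤ c → ∃ C : ℝ, 0 < C ∧
      ∀ (n B : ℕ) (_ : 1 ≤ n) (hB : 0 < B) (_ : Real.log n / B ≤ η)
        (k h : Fin m → ℕ) (_ : ∀ j, 1 ≤ k j) (_ : ∀ j, 1 ≤ h j)
        (_ : Pairwise fun i j =>
          Disjoint (Finset.Ico (k i) (k i + h i)) (Finset.Ico (k j) (k j + h j)))
        (Ω : Type*) [MeasurableSpace Ω] (μ : Measure Ω) [IsProbabilityMeasure μ]
        (z : Fin B → ℕ → Ω → ℝ) (_ : IsIIDInnovations z μ)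
        (_ : HasExpTail (panelObs (scmCoeff ρ ε k h) z n ⟨0, hB⟩) μ η K)
        -- any choice of a solution of the minimization problem, arbitrary where there is none
        (Om : Ω → Matrix (Fin n) (Fin n) ℝ)
        (_ : ∀ ω, (∃ A, IsClimeSolution
              (sampleCov fun j i => panelObs (scmCoeff ρ ε k h) z n j i ω)
              (c * √(Real.log n / B)) A) →
            IsClimeSolution
              (sampleCov fun j i => panelObs (scmCoeff ρ ε k h) z n j i ω)
              (c * √(Real.log n / B)) (Om ω)),
        -- the event contains a measurable one of the stated probability, so that no
        -- measurability of the choice `Om` is needed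
        ∃ G : Set Ω, MeasurableSet G ∧ 1 - 4 * (n : ℝ) ^ (-τ) ≤ μ.real G ∧
          ∀ ω ∈ G, ∀ i : Fin n,
            |orderedEigenvalue (minSymm_isHermitian (Om ω)) i -
                orderedEigenvalue
                  (precisionMatrix_isHermitian
                    (panelObs (scmCoeff ρ ε k h) z n ⟨0, hB⟩) μ) i|
              ≤ C * √(Real.log n / B) := by
  have hV0 : 0 < K / η := div_pos hK hη0
  have hD0 := deviationConst_pos hη0 hK hτ
  set D := deviationConst η K τ
  set M := (1 + √(K / η)) ^ 2
  have hM : 0 < M := by positivity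
  have hq1 : √(1 - (K / η)⁻¹) < 1 := by
    rw [Real.sqrt_lt' one_pos]
    have := inv_pos.2 hV0
    linarith
  have hW : 0 < K / η * (2 * (1 - √(1 - (K / η)⁻¹))⁻¹) := by
    have := inv_pos.2 (sub_pos.2 hq1)
    positivity
  obtain ⟨C, hC, hdet⟩ := exists_rowSum_minSymm_sub_le hM hW
  have hc₀ : 0 < 4 * M * (D + D ^ 2) := by positivity
  -- This `c₀` is what `4 M σ ≤ lam` requires for `σ = (D + D²) a` and `lam = c a`.
  refine ⟨4 * M * (D + D ^ 2), hc₀, fun c hc => ⟨C * c, mul_pos hC (hc₀.trans_le hc), ?_⟩⟩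
  intro n B hn hB hnB k h _ _ _ Ω _ μ _ z hz htail Om hOm
  -- For `n = 1` the radius `lam` is zero, but the required probability is negative, so the empty
  -- event suffices.
  rcases hn.eq_or_lt with hn1 | hn1
  · refine ⟨∅, MeasurableSet.empty, ?_, fun ω hω => absurd hω (Set.notMem_empty ω)⟩
    simp [← hn1]
  set r := scmCoeff ρ ε k h
  set a := √(Real.log n / B) with ha
  have ha0 : 0 < a := Real.sqrt_pos.2 (div_pos (Real.log_pos (by exact_mod_cast hn1))
    (by exact_mod_cast hB))
  obtain ⟨G, hGm, hG, hclose⟩ := hz.exists_sampleCov_close hB hn r hη0 hη.le hK hτ hnB htail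
  refine ⟨G, hGm, hG, fun ω hω i => ?_⟩
  have hwn := hz.isWhiteNoise ⟨0, hB⟩
  have hvar : ∀ t, 1 ≤ t → t ≤ n →
      cov[arProc r (z ⟨0, hB⟩) t, arProc r (z ⟨0, hB⟩) t; μ] ≤ K / η := by
    intro t ht htn
    have h1 := htail.integral_sq_le hη0 (fun i => hwn.memLp_arProc r (i + 1)) ⟨t - 1, by omega⟩
    rw [covariance_eq_sub (hwn.memLp_arProc r t) (hwn.memLp_arProc r t), hwn.integral_arProc,
      zero_mul, sub_zero]
    simp only [panelObs, Nat.sub_add_cancel ht, sq] at h1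
    exact h1
  have hbanded := hwn.bandedApprox r hV0 hvar (σ := (D + D ^ 2) * a) (lam := c * a)
    (by positivity) (mul_pos (hc₀.trans_le hc) ha0)
    (by rw [← mul_assoc]; exact mul_le_mul_of_nonneg_right hc ha0.le) (hclose ω hω)
  have hsol := hOm ω (exists_isClimeSolution hbanded.feasible_inv)
  refine abs_orderedEigenvalue_sub_le _ _ (fun i => ?_) i
  rw [mul_assoc]
  exact hdet n _ _ _ _ _ _ hbanded hsol i
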